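/- Let $k\ge 2$ and $n\ge 3$ be integers and let $G$ be a balanced $k$-partite graph on $n$ vertices, that is, a (finite, simple) graph whose vertex set can be partitioned into $k$ independent sets, each of size exactly $n/k$. Put $$D(n,k)=\left\lceil\frac n2\right\rceil+\left\lfloor\frac{n+2}{2\lceil (k+1)/2\rceil}\right\rfloor-\frac nk .$$ Then $D(n,k)=\lceil\frac n2\rceil+\lfloor\frac{n+2}{k+1}\rfloor-\frac nk$ if $k$ is odd and $D(n,k)=\frac n2+\lfloor\frac{n+2}{k+2}\rfloor-\frac nk$ if $k$ is even. If the minimum degree satisfies $\delta(G)\ge D(n,k)$, then $G$ has a Hamiltonian cycle, unless $4$ divides $n$ and either $k=2$ or $k=\frac n2$ (in these exceptional cases nothing is claimed). Moreover, the degree condition of Chen, Faudree, Gould, Jacobson and Lesniak, $\delta(G)>\frac n2+\frac{n}{2\lceil (k+1)/2\rceil}-\frac nk$, implies $\delta(G)\ge D(n,k)$. If $k=n$, then $D(n,k)=\lceil\frac n2\rceil$ (the condition in Dirac's theorem), and if $k=2$, then $D(n,k)=\lfloor\frac{n+2}{4}\rfloor$ (the condition in the theorem of Moon and Moser). -/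

import Mathlib

/-- `G` is a balanced `k`-partite graph: its vertex set can be partitioned into `k` independent
sets (the classes of a proper colouring by `Fin k`) which all have the same size. -/
def IsBalancedKPartite {V : Type*} [Fintype V] (G : SimpleGraph V) (k : ℕ) : Prop :=
  ∃ c : G.Coloring (Fin k), ∃ m : ℕ, ∀ i : Fin k,
    (Finset.univ.filter (fun v : V => c v = i)).card = m

/-- The number `⌈n/2⌉ + ⌊(n+2) / (2⌈(k+1)/2⌉)⌋ - n/k`, with exact (rational) divisions. -/
def degreeThreshold (n k : ℕ) : ℚ :=
  (⌈(n : ℚ) / 2⌉ : ℚ) + (⌊((n : ℚ) + 2) / (2 * (⌈((k : ℚ) + 1) / 2⌉ : ℚ))⌋ : ℚ) - (n : ℚ) / (k : ℚ)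

/-!
Let `n = k * m`, let `d` be the bound on the degrees, and let `e = m - ⌊(n + 2) / (2⌊k/2⌋ + 2)⌋`, so
that `d = ⌈n/2⌉ - e`. If `e ≤ 0`, Dirac's theorem applies. For `k = 2` the graph is bipartite with
parts of odd size (`4 ∤ n`), and a spanning path between the parts can be closed by a crossing
argument (`hasSpanningCycle_of_bipartite`). So let `k ≥ 3` and `e ≥ 1`, and suppose that there is no
Hamiltonian cycle.

*Reduction to a cycle that misses one vertex.* Edges between different classes may be added as long
as no Hamiltonian cycle appears. In a graph that is maximal in this sense the vertices can be
covered by a path (`exists_le_isPathList`), hence by a cycle and a disjoint path `R` that begins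
next to the cycle. Choose such a cover with `R` as short as possible (`IsExtremal`). Neighbours on
the cycle of the same end of `R` are not consecutive, and distinct neighbours of different ends have
at least `|R|` vertices between them, as otherwise `R` could be shortened. Counting around the cycle
shows that, if `|R| ≥ 2`, the degrees are too small (`IsExtremal.degree_bound`) unless cycle and
path are joined through one vertex only. In that case, rotating paths inside the two sides produces
many vertices with all neighbours on one side, and the colour classes leave too few neighbours for
them on the smaller side (`IsExtremal.length_eq_one`). So `R` is a single vertex `w`.

*Exchanges.* A vertex `y` of the cycle lying between two neighbours of `w` can change places with
`w`. Let `Y` be the set of these vertices together with `w` (`exchSet`), `X` the set of their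
neighbours (`exchNbrs`), and `T⁺`, `T⁻` the sets of successors and predecessors of the neighbours of
`w`, each with `w` added. Then `X` contains no two consecutive vertices (one step of Woodall's
hopping argument), `T⁺` and `T⁻` are independent, and `T⁺ ∩ T⁻ = Y`. As `|N(w)| ≥ ⌈n/2⌉ - e`, the
set `Y` is nearly all of `T⁺` and of `T⁻`. Each class meeting `Y` has many vertices outside `X`,
while `X` has nearly half of all vertices, so that the floor in the degree condition is just what
gives that `Y` meets at most `⌊k/2⌋` classes (`MissesOne.card_image_exchSet_le`).

*Odd `k`.* The `⌊k/2⌋` classes are too small to contain `T⁺`, so that some vertex of `T⁺` lies in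
another class. It has no neighbours in `T⁺`, so a large part of its class lies in `T⁺ \ Y`, which is
a small set (`MissesOne.false_of_odd`).

*Even `k`.* Now `Y` meets exactly half of the classes; let `A` be their union. If `T⁺` and `T⁻` lie
in `A`, a vertex outside `A` and `X` has too many non-neighbours. If neither does, the vertices of
`T⁺ \ A` and `T⁻ \ A` are too many. If exactly one of them does, then `k = 4` and all estimates are
tight; the adjacencies forced by this give a Hamiltonian cycle through two chords
(`MissesOne.not_adj_of_two_chords`, `MissesOne.false_of_subset_of_not_subset`). The estimates for
even `k` need `m ≥ 3`; the case `m = 1` is covered by Dirac's theorem, and for `m = 2` the number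
`n = 2 * k` is divisible by four.
-/

namespace BalancedPartite

open Finset

set_option linter.unusedSectionVars false

/-! ### Vertex lists as paths and cycles -/

section Lists

variable {V : Type*} {G : SimpleGraph V}

/-- `l` is the vertex list of a walk of `G` from `a` to `b`. Repetitions are excluded separately,
by conditions on `List.count`, which makes cutting and gluing lists a matter of linear
arithmetic. -/
structure IsPathList (G : SimpleGraph V) (a b : V) (l : List V) : Prop where
  chain : l.IsChain G.Adj
  head : l.head? = some a
  last : l.getLast? = some b

theorem IsPathList.single (a : V) : IsPathList G a a [a] := ⟨by simp, by simp, by simp⟩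

theorem IsPathList.append {a b c d : V} {l l' : List V} (h : IsPathList G a b l)
    (h' : IsPathList G c d l') (hbc : G.Adj b c) : IsPathList G a d (l ++ l') := by
  refine ⟨?_, ?_, ?_⟩
  · rw [List.isChain_append]
    refine ⟨h.chain, h'.chain, ?_⟩
    intro x hx y hy
    rw [h.last] at hx; rw [h'.head] at hy
    simp at hx hy; subst hx; subst hy; exact hbc
  · rw [List.head?_append, h.head]; rfl
  · rw [List.getLast?_append, h'.last]; rfl

theorem IsPathList.cons {a c d : V} {l : List V} (h : IsPathList G c d l) (hac : G.Adj a c) :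
    IsPathList G a d (a :: l) := (IsPathList.single a).append h hac

theorem IsPathList.reverse {a b : V} {l : List V} (h : IsPathList G a b l) :
    IsPathList G b a l.reverse := by
  refine ⟨?_, by rw [List.head?_reverse, h.last], by rw [List.getLast?_reverse, h.head]⟩
  rw [List.isChain_reverse]
  exact h.chain.imp fun _ _ hxy => hxy.symm

theorem IsPathList.ne_nil {a b : V} {l : List V} (h : IsPathList G a b l) : l ≠ [] := by
  rintro rfl; simpa using h.head

theorem IsPathList.left_mem {a b : V} {l : List V} (h : IsPathList G a b l) : a ∈ l :=
  List.mem_of_mem_head? h.head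

theorem IsPathList.right_mem {a b : V} {l : List V} (h : IsPathList G a b l) : b ∈ l :=
  List.mem_of_mem_getLast? h.last

theorem isPathList_of_isChain {l : List V} (h : l.IsChain G.Adj) (hl : l ≠ []) :
    ∃ a b, IsPathList G a b l :=
  ⟨l.head hl, l.getLast hl, h, List.head?_eq_some_head hl, List.getLast?_eq_some_getLast hl⟩

theorem IsPathList.split {a b x y : V} {l₁ l₂ : List V}
    (h : IsPathList G a b (l₁ ++ x :: y :: l₂)) :
    IsPathList G a x (l₁ ++ [x]) ∧ IsPathList G y b (y :: l₂) ∧ G.Adj x y := by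
  have hc := h.chain
  have e : l₁ ++ x :: y :: l₂ = (l₁ ++ [x]) ++ (y :: l₂) := by simp
  rw [e, List.isChain_append] at hc
  refine ⟨⟨hc.1, ?_, by simp⟩, ⟨hc.2.1, by simp, ?_⟩, hc.2.2 x (by simp) y (by simp)⟩
  · have := h.head
    rw [e, List.head?_append] at this
    cases l₁ <;> simpa using this
  · have := h.last
    rw [e, List.getLast?_append] at this
    have h2 : (y :: l₂).getLast? = some ((y :: l₂).getLast (by simp)) :=
      List.getLast?_eq_some_getLast (by simp)
    rw [h2] at this ⊢
    simpa using this

/-- A path list is the support of a walk. -/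
theorem IsPathList.exists_walk {l : List V} : ∀ {a b : V}, IsPathList G a b l →
    ∃ p : G.Walk a b, p.support = l := by
  induction l with
  | nil => intro a b h; exact absurd rfl h.ne_nil
  | cons x l ih =>
    intro a b h
    have hx : x = a := by simpa using h.head
    subst hx
    cases l with
    | nil =>
      have : x = b := by simpa using h.last
      subst this
      exact ⟨.nil, rfl⟩
    | cons y l =>
      obtain ⟨-, h2, h3⟩ := IsPathList.split (l₁ := []) h
      obtain ⟨p, hp⟩ := ih h2
      exact ⟨.cons h3 p, by simp [hp]⟩

variable [DecidableEq V]

/-- `G` has a spanning cycle, given by a list of its vertices. The closing edge `b a` makes this a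
cycle in the graph-theoretic sense as soon as there are at least three vertices. -/
def HasSpanningCycle (G : SimpleGraph V) : Prop :=
  ∃ a b l, IsPathList G a b l ∧ G.Adj b a ∧ ∀ v, l.count v = 1

theorem nodup_of_count_eq_one {l : List V} (h : ∀ v, l.count v = 1) : l.Nodup :=
  List.nodup_iff_count_le_one.2 fun v => (h v).le

theorem mem_of_count_eq_one {l : List V} (h : ∀ v, l.count v = 1) (v : V) : v ∈ l :=
  List.count_pos_iff.1 (by rw [h v]; exact one_pos)

theorem length_of_count_eq_one [Fintype V] {l : List V} (h : ∀ v, l.count v = 1) :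
    l.length = Fintype.card V := by
  rw [← List.toFinset_card_of_nodup (nodup_of_count_eq_one h)]
  rw [← Finset.card_univ]
  congr 1
  ext v; simp [mem_of_count_eq_one h v]

theorem HasSpanningCycle.exists_isHamiltonianCycle [Fintype V] (h : HasSpanningCycle G)
    (hn : 3 ≤ Fintype.card V) : ∃ (a : V) (p : G.Walk a a), p.IsHamiltonianCycle := by
  obtain ⟨a, b, l, hl, hab, hc⟩ := h
  obtain ⟨p, hp⟩ := hl.exists_walk
  refine ⟨b, .cons hab p, ?_⟩
  have hlen : p.length + 1 = Fintype.card V := by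
    rw [← p.length_support, hp, length_of_count_eq_one hc]
  have hpath : p.IsPath := by
    rw [SimpleGraph.Walk.isPath_def, hp]; exact nodup_of_count_eq_one hc
  rw [SimpleGraph.Walk.isHamiltonianCycle_iff_isCycle_and_support_count_tail_eq_one]
  constructor
  · rw [SimpleGraph.Walk.cons_isCycle_iff]
    refine ⟨hpath, fun he => ?_⟩
    have h2 := hpath.length_eq_one_of_mem_edges (by rwa [Sym2.eq_swap] at he)
    omega
  · intro v; simp [hp, hc v]

/-- The successors along `l` of a set `Q` of vertices not containing the last one. -/
theorem exists_successors {l : List V} (hl : l.Nodup) (Q : Finset V) (hQ : ∀ x ∈ Q, x ∈ l)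
    (hlast : ∀ b ∈ l.getLast?, b ∉ Q) :
    ∃ U : Finset V, #U = #Q ∧ ∀ u ∈ U, ∃ l₁ x l₂, l = l₁ ++ x :: u :: l₂ ∧ x ∈ Q := by
  refine ⟨Q.image l.formPerm, Finset.card_image_of_injective _ l.formPerm.injective, ?_⟩
  intro u hu
  obtain ⟨x, hx, rfl⟩ := Finset.mem_image.1 hu
  obtain ⟨l₁, l₂, rfl⟩ := List.append_of_mem (hQ x hx)
  cases l₂ with
  | nil => exact absurd hx (hlast x (by simp))
  | cons y l₂ =>
    refine ⟨l₁, x, l₂, ?_, hx⟩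
    have h := List.formPerm_apply_lt_getElem _ hl l₁.length (by simp)
    simp at h
    rw [h]

end Lists

/-! ### Arcs of a cyclic permutation -/

section Arcs

variable {V : Type*} {σ : Equiv.Perm V}

/-- The first `k` iterates of `x` under `σ`. -/
def arc (σ : Equiv.Perm V) (x : V) (k : ℕ) : List V := (List.range k).map fun i => (σ ^ i) x

theorem arc_length (x : V) (k : ℕ) : (arc σ x k).length = k := by simp [arc]

theorem arc_add (x : V) (k l : ℕ) : arc σ x (k + l) = arc σ x k ++ arc σ ((σ ^ k) x) l := by
  simp only [arc, List.range_add, List.map_append, List.map_map, Function.comp_def]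
  congr 1
  refine List.map_congr_left fun i _ => ?_
  rw [add_comm, pow_add, Equiv.Perm.mul_apply]

theorem arc_succ (x : V) (k : ℕ) : arc σ x (k + 1) = x :: arc σ (σ x) k := by
  rw [add_comm, arc_add]; simp [arc]

/-- `l` runs through the arc of `σ` from `x` to `e`, both included. -/
inductive ArcList (σ : Equiv.Perm V) : V → V → List V → Prop
  | single (x : V) : ArcList σ x x [x]
  | cons {x e : V} {l : List V} : ArcList σ (σ x) e l → ArcList σ x e (x :: l)

theorem arcList_arc (k : ℕ) : ∀ x : V, ArcList σ x ((σ ^ k) x) (arc σ x (k + 1)) := by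
  induction k with
  | zero => intro x; simpa [arc] using ArcList.single x
  | succ k ih =>
    intro x
    rw [arc_succ]
    have := ih (σ x)
    rw [← Equiv.Perm.mul_apply, ← pow_succ] at this
    exact this.cons

theorem ArcList.uncons {x e : V} {l : List V} (h : ArcList σ x e l) (hxe : x ≠ e) :
    ∃ l', l = x :: l' ∧ ArcList σ (σ x) e l' := by
  cases h with
  | single => exact absurd rfl hxe
  | cons h => exact ⟨_, rfl, h⟩

variable {G : SimpleGraph V} {S : Finset V}

/-- `σ` runs through a cycle of `G` with vertex set `S`. -/
structure IsCyclePerm (G : SimpleGraph V) (S : Finset V) (σ : Equiv.Perm V) : Prop where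
  cyc : σ.IsCycleOn (S : Set V)
  adj : ∀ x ∈ S, G.Adj x (σ x)

namespace IsCyclePerm

theorem apply_mem (h : IsCyclePerm G S σ) {x : V} : σ x ∈ S ↔ x ∈ S := by
  simpa using h.cyc.apply_mem_iff (x := x)

theorem inv_mem (h : IsCyclePerm G S σ) {x : V} : σ⁻¹ x ∈ S ↔ x ∈ S := by
  rw [← h.apply_mem]; simp

theorem pow_mem (h : IsCyclePerm G S σ) {x : V} (k : ℕ) (hx : x ∈ S) : (σ ^ k) x ∈ S := by
  induction k with
  | zero => simpa
  | succ k ih => rw [pow_succ', Equiv.Perm.mul_apply, h.apply_mem]; exact ih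

/-- Reversing the orientation of the cycle. -/
theorem inv (h : IsCyclePerm G S σ) : IsCyclePerm G S σ⁻¹ := by
  refine ⟨h.cyc.inv, fun x hx => ?_⟩
  have := h.adj (σ⁻¹ x) (h.inv_mem.2 hx)
  simpa using this.symm

theorem isPathList (h : IsCyclePerm G S σ) {x e : V} {l : List V} (hl : ArcList σ x e l)
    (hx : x ∈ S) : IsPathList G x e l := by
  induction hl with
  | single => exact .single _
  | @cons x e l _ ih => exact (ih (h.apply_mem.2 hx)).cons (h.adj x hx)

theorem isChain_arc (h : IsCyclePerm G S σ) {x : V} (hx : x ∈ S) (k : ℕ) :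
    (arc σ x k).IsChain G.Adj := by
  cases k with
  | zero => simp [arc]
  | succ k => exact (h.isPathList (arcList_arc k x) hx).chain

variable [DecidableEq V]

theorem count_arc (h : IsCyclePerm G S σ) {x : V} (hx : x ∈ S) (v : V) :
    (arc σ x #S).count v = if v ∈ S then 1 else 0 := by
  have hnd : (arc σ x #S).Nodup := by
    refine List.Nodup.map_on ?_ List.nodup_range
    intro i hi j hj hij
    rw [h.cyc.pow_apply_eq_pow_apply hx] at hij
    rw [List.mem_range] at hi hj
    exact Nat.ModEq.eq_of_lt_of_lt hij hi hj
  have hm : v ∈ arc σ x #S ↔ v ∈ S := by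
    constructor
    · intro hv
      obtain ⟨i, -, rfl⟩ := List.mem_map.1 hv
      exact h.pow_mem i hx
    · intro hv
      obtain ⟨i, hi, rfl⟩ := h.cyc.exists_pow_eq hx hv
      exact List.mem_map.2 ⟨i, List.mem_range.2 hi, rfl⟩
  rw [List.Nodup.count hnd]
  simp [hm]

/-- Opening the cycle just before `x`. -/
theorem cut_one (h : IsCyclePerm G S σ) {x : V} (hx : x ∈ S) :
    ∃ A, ArcList σ x (σ⁻¹ x) A ∧ ∀ v, A.count v = if v ∈ S then 1 else 0 := by
  have hpos : 0 < #S := Finset.card_pos.2 ⟨x, hx⟩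
  obtain ⟨N, hN⟩ := Nat.exists_eq_succ_of_ne_zero hpos.ne'
  refine ⟨arc σ x #S, ?_, h.count_arc hx⟩
  have := arcList_arc (σ := σ) N x
  have e : (σ ^ N) x = σ⁻¹ x := by
    rw [Equiv.Perm.eq_inv_iff_eq, ← Equiv.Perm.mul_apply, ← pow_succ', ← Nat.succ_eq_add_one, ← hN]
    exact h.cyc.pow_card_apply hx
  rw [e] at this
  rw [hN]; exact this

/-- An arc starting at `x` that passes through `y ≠ x` can be cut just before `y`. -/
theorem _root_.BalancedPartite.ArcList.cut {x e : V} {l : List V} (hl : ArcList σ x e l) {y : V}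
    (hy : y ∈ l) (hxy : y ≠ x) :
    ∃ A B, l = A ++ B ∧ ArcList σ x (σ⁻¹ y) A ∧ ArcList σ y e B := by
  induction hl with
  | single => simp at hy; exact absurd hy hxy
  | @cons x e l h ih =>
    by_cases hy' : y = σ x
    · subst hy'
      exact ⟨[x], l, rfl, by simpa using ArcList.single x, h⟩
    · have : y ∈ l := by simpa [hxy] using hy
      obtain ⟨A, B, rfl, hA, hB⟩ := ih this hy'
      exact ⟨x :: A, B, rfl, hA.cons, hB⟩

/-- Opening the cycle just before `x` and before `y`. -/
theorem cut_two (h : IsCyclePerm G S σ) {x y : V} (hx : x ∈ S) (hy : y ∈ S) (hxy : x ≠ y) :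
    ∃ A B, ArcList σ x (σ⁻¹ y) A ∧ ArcList σ y (σ⁻¹ x) B ∧
      ∀ v, A.count v + B.count v = if v ∈ S then 1 else 0 := by
  obtain ⟨l, hl, hc⟩ := h.cut_one hx
  have : y ∈ l := List.count_pos_iff.1 (by rw [hc]; simp [hy])
  obtain ⟨A, B, rfl, hA, hB⟩ := hl.cut this hxy.symm
  exact ⟨A, B, hA, hB, fun v => by rw [← hc v, List.count_append]⟩

/-- Opening the cycle just before three distinct vertices. There are two cyclic orders. -/
theorem cut_three (h : IsCyclePerm G S σ) {x y z : V} (hx : x ∈ S) (hy : y ∈ S) (hz : z ∈ S)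
    (hxy : x ≠ y) (hxz : x ≠ z) (hyz : y ≠ z) :
    (∃ A B D, ArcList σ x (σ⁻¹ y) A ∧ ArcList σ y (σ⁻¹ z) B ∧ ArcList σ z (σ⁻¹ x) D ∧
      ∀ v, A.count v + B.count v + D.count v = if v ∈ S then 1 else 0) ∨
    (∃ A B D, ArcList σ x (σ⁻¹ z) A ∧ ArcList σ z (σ⁻¹ y) B ∧ ArcList σ y (σ⁻¹ x) D ∧
      ∀ v, A.count v + B.count v + D.count v = if v ∈ S then 1 else 0) := by
  obtain ⟨A, B, hA, hB, hc⟩ := h.cut_two hx hy hxy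
  have hz' : z ∈ A ∨ z ∈ B := by
    have := hc z
    rw [if_pos hz] at this
    rw [← List.count_pos_iff, ← List.count_pos_iff]; omega
  rcases hz' with hz' | hz'
  · obtain ⟨A₁, A₂, rfl, h1, h2⟩ := hA.cut hz' hxz.symm
    exact .inr ⟨A₁, A₂, B, h1, h2, hB, fun v => by rw [← hc v, List.count_append]⟩
  · obtain ⟨B₁, B₂, rfl, h1, h2⟩ := hB.cut hz' hyz.symm
    exact .inl ⟨A, B₁, B₂, hA, h1, h2, fun v => by rw [← hc v, List.count_append]; omega⟩

end IsCyclePerm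

/-- A closed path list gives a cyclic permutation. -/
theorem IsPathList.exists_isCyclePerm [DecidableEq V] {a b : V} {l : List V}
    (h : IsPathList G a b l) (hba : G.Adj b a) (hl : l.Nodup) :
    IsCyclePerm G l.toFinset l.formPerm := by
  constructor
  · convert hl.isCycleOn_formPerm
    ext; simp
  · intro x hx
    rw [List.mem_toFinset] at hx
    obtain ⟨i, hi, rfl⟩ := List.getElem_of_mem hx
    rw [List.formPerm_apply_getElem _ hl]
    have h0 : 0 < l.length := by omega
    rcases Nat.lt_or_ge (i + 1) l.length with h1 | h1
    · have := List.isChain_iff_getElem.1 h.chain i h1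
      simpa [Nat.mod_eq_of_lt h1] using this
    · have e : i + 1 = l.length := by omega
      have ea : l[0] = a := by
        have := h.head; rw [List.head?_eq_getElem?, List.getElem?_eq_getElem h0] at this
        simpa using this
      have eb : l[i] = b := by
        have := h.last; rw [List.getLast?_eq_getElem?] at this
        have e2 : l.length - 1 = i := by omega
        rw [e2, List.getElem?_eq_getElem hi] at this
        simpa using this
      simp only [e, Nat.mod_self, ea, eb]; exact hba

end Arcs

/-! ### Spanning paths in edge-maximal graphs, and Dirac's theorem -/

section Maximal

variable {V : Type*} {G K : SimpleGraph V}

/-- A list whose first and last vertices are `y` and `x` does not use the edge `xy`. -/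
theorem isChain_of_isChain_of_ends {G' : SimpleGraph V} {x y : V} {l : List V}
    (h : IsPathList G' y x l) (hl : l.Nodup) (h3 : 3 ≤ l.length)
    (hG : ∀ p q, G'.Adj p q → ¬ G.Adj p q → s(p, q) = s(x, y)) : IsPathList G y x l := by
  refine ⟨?_, h.head, h.last⟩
  rw [List.isChain_iff_forall_rel_of_append_cons_cons]
  rintro p q m₁ m₂ rfl
  by_contra hpq
  have hadj := (List.isChain_iff_forall_rel_of_append_cons_cons.1 h.chain) (rfl : _ = _)
  have hlast := h.last
  have hhead := h.head
  rw [show m₁ ++ p :: q :: m₂ = (m₁ ++ [p]) ++ (q :: m₂) by simp, List.getLast?_append] at hlast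
  have e := hG p q hadj hpq
  rw [Sym2.eq_iff] at e
  obtain ⟨rfl, rfl⟩ | ⟨rfl, rfl⟩ := e
  · have hx : p ∈ q :: m₂ := by
      have e2 : (q :: m₂).getLast? = some ((q :: m₂).getLast (by simp)) :=
        List.getLast?_eq_some_getLast (by simp)
      rw [e2] at hlast
      simp only [Option.some_or, Option.some.injEq] at hlast
      rw [← hlast]; exact List.getLast_mem _
    rw [List.nodup_append] at hl
    exact (List.nodup_cons.1 hl.2.1).1 hx
  · cases m₁ with
    | nil =>
      cases m₂ with
      | nil => simp at h3
      | cons z m₂ =>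
        have hx : q ∈ z :: m₂ := by
          have e2 : (q :: z :: m₂).getLast? = some ((z :: m₂).getLast (by simp)) := by
            rw [List.getLast?_eq_some_getLast (by simp)]; simp
          rw [e2] at hlast
          simp only [Option.some_or, Option.some.injEq] at hlast
          rw [← hlast]; exact List.getLast_mem _
        simp at hl
        simp at hx
        rcases hx with hx | hx
        · exact hl.2.1.1 hx
        · exact hl.2.1.2 hx
    | cons z m₁ =>
      simp at hhead
      subst hhead
      simp at hl

theorem card_eq_mul_of_classes [Fintype V] {k m : ℕ} {c : V → Fin k}
    (hm : ∀ i, #{v | c v = i} = m) :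
    Fintype.card V = k * m := by
  rw [← card_univ, Finset.card_eq_sum_card_fiberwise (f := c) (t := univ) (by simp)]
  simp [hm]

variable [DecidableEq V]

theorem HasSpanningCycle.of_path {a b : V} {l : List V} (h : IsPathList G a b l)
    (hab : G.Adj b a) (hc : ∀ v, l.count v = 1) : HasSpanningCycle G := ⟨a, b, l, h, hab, hc⟩

/-- If `G ≤ K`, where `K` has a spanning cycle and `G` has none, then an edge-maximal such graph
between `G` and `K` has a spanning path whose ends are adjacent in `K`. -/
theorem exists_le_isPathList [Fintype V] (hGK : G ≤ K) (hG : ¬ HasSpanningCycle G)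
    (hK : HasSpanningCycle K) (h3 : 3 ≤ Fintype.card V) :
    ∃ G', G ≤ G' ∧ G' ≤ K ∧ ¬ HasSpanningCycle G' ∧
      ∃ a b l, IsPathList G' a b l ∧ K.Adj b a ∧ ∀ v, l.count v = 1 := by
  classical
  obtain ⟨G', hGG', hmax⟩ := (Set.toFinite {G' | G' ≤ K ∧ ¬ HasSpanningCycle G'}).exists_le_maximal
    (a := G) ⟨hGK, hG⟩
  obtain ⟨hG'K, hG'⟩ := hmax.prop
  refine ⟨G', hGG', hG'K, hG', ?_⟩
  have hne : ∃ u v, K.Adj u v ∧ ¬ G'.Adj u v := by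
    by_contra! hcon
    exact hG' (by rwa [le_antisymm hG'K (fun u v h => hcon u v h)])
  obtain ⟨u, v, huv, huv'⟩ := hne
  set G₂ := G' ⊔ SimpleGraph.edge u v with hG₂
  have hG₂K : G₂ ≤ K := sup_le hG'K ((SimpleGraph.edge_le_iff _).2 (.inr huv))
  have hG₂s : HasSpanningCycle G₂ := by
    by_contra hcon
    have := hmax.le_of_ge ⟨hG₂K, hcon⟩ le_sup_left
    refine huv' (this ?_)
    simp [hG₂, SimpleGraph.edge_adj, huv.ne]
  obtain ⟨a, b, l, hl, hba, hc⟩ := hG₂s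
  have hnew : ∀ p q, G₂.Adj p q → ¬ G'.Adj p q → s(p, q) = s(u, v) := by
    intro p q h h'
    rw [hG₂, SimpleGraph.sup_adj] at h
    have := h.resolve_left h'
    rw [SimpleGraph.edge_adj] at this
    rw [Sym2.eq_iff]; exact this.1
  have hnd := nodup_of_count_eq_one hc
  have hlen := length_of_count_eq_one hc
  by_cases hch : l.IsChain G'.Adj
  · exact ⟨a, b, l, ⟨hch, hl.head, hl.last⟩, hG₂K hba, hc⟩
  · rw [List.isChain_iff_forall_rel_of_append_cons_cons] at hch
    push Not at hch
    obtain ⟨x, y, l₁, l₂, rfl, hxy⟩ := hch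
    obtain ⟨h1, h2, h12⟩ := hl.split
    have hc' : ∀ v, ((y :: l₂) ++ (l₁ ++ [x])).count v = 1 := by
      intro v; have := hc v; simp [List.count_cons, List.count_append] at this ⊢; omega
    refine ⟨y, x, (y :: l₂) ++ (l₁ ++ [x]), ?_, hG₂K h12, hc'⟩
    refine isChain_of_isChain_of_ends (h2.append h1 hba) (nodup_of_count_eq_one hc')
      (by rw [length_of_count_eq_one hc']; exact h3) ?_
    intro p q hpq hpq'
    rw [hnew p q hpq hpq', hnew x y h12 hxy]

variable [Fintype V] [DecidableRel G.Adj]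

/-- If the neighbours of the first vertex of a spanning path and the successors of the neighbours
of the last one lie in a set that is too small, then the path closes up to a cycle. -/
theorem IsPathList.hasSpanningCycle_of_card_lt {a b : V} {l : List V} (h : IsPathList G a b l)
    (hc : ∀ v, l.count v = 1) (D : Finset V) (ha : G.neighborFinset a ⊆ D)
    (hb : ∀ x y, ∀ l₁ l₂, l = l₁ ++ x :: y :: l₂ → G.Adj b x → y ∈ D)
    (hD : #D < G.degree a + G.degree b) : HasSpanningCycle G := by
  obtain ⟨U, hU, hU'⟩ := exists_successors (nodup_of_count_eq_one hc) (G.neighborFinset b)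
    (fun x _ => mem_of_count_eq_one hc x) (by
      intro x hx; rw [h.last] at hx; simp at hx; subst hx; simp)
  have hUD : U ⊆ D := by
    intro u hu
    obtain ⟨l₁, x, l₂, e, hx⟩ := hU' u hu
    exact hb x u l₁ l₂ e (by simpa using hx)
  have hne : ¬ Disjoint (G.neighborFinset a) U := by
    intro hd
    have h1 := Finset.card_union_of_disjoint hd
    have h2 := Finset.card_le_card (Finset.union_subset ha hUD)
    rw [SimpleGraph.card_neighborFinset_eq_degree] at *
    omega
  rw [Finset.not_disjoint_iff] at hne
  obtain ⟨u, hu, hu'⟩ := hne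
  obtain ⟨l₁, x, l₂, rfl, hx⟩ := hU' u hu'
  rw [SimpleGraph.mem_neighborFinset] at hu hx
  obtain ⟨h1, h2, -⟩ := h.split
  refine .of_path (h1.append h2.reverse hx.symm) hu.symm fun v => ?_
  rw [← hc v]; simp [List.count_cons, List.count_append]

theorem hasSpanningCycle_top (h3 : 3 ≤ Fintype.card V) : HasSpanningCycle (⊤ : SimpleGraph V) := by
  have hlen : (Finset.univ : Finset V).toList.length = Fintype.card V := by simp
  have hnd := (Finset.univ : Finset V).nodup_toList
  have hc : ∀ v, (Finset.univ : Finset V).toList.count v = 1 := fun v =>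
    List.count_eq_one_of_mem hnd (by simp)
  generalize (Finset.univ : Finset V).toList = l at *
  have hch : l.IsChain (⊤ : SimpleGraph V).Adj := by
    exact hnd.isChain
  obtain ⟨a, b, h⟩ := isPathList_of_isChain hch (by rintro rfl; simp at hlen; omega)
  refine .of_path h ?_ hc
  rw [SimpleGraph.top_adj]
  rintro rfl
  match l, hlen with
  | x :: y :: l, _ =>
    have h1 := h.head
    have h2 := h.last
    simp only [List.head?_cons, Option.some.injEq, List.getLast?_cons_cons] at h1 h2
    subst h1
    exact (List.nodup_cons.1 hnd).1 (List.mem_of_mem_getLast? h2)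
  | [x], hl => simp at hl; omega
  | [], hl => simp at hl; omega

/-- Dirac's theorem. -/
theorem hasSpanningCycle_of_card_le (h3 : 3 ≤ Fintype.card V)
    (hdeg : ∀ v, Fintype.card V ≤ 2 * G.degree v) : HasSpanningCycle G := by
  classical
  by_contra hG
  obtain ⟨G', hGG', -, hG', a, b, l, hl, -, hc⟩ :=
    exists_le_isPathList le_top hG (hasSpanningCycle_top h3) h3
  refine hG' (hl.hasSpanningCycle_of_card_lt hc (univ.erase a) ?_ ?_ ?_)
  · intro x hx
    rw [SimpleGraph.mem_neighborFinset] at hx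
    simp [hx.ne']
  · rintro x y l₁ l₂ rfl -
    refine mem_erase.2 ⟨?_, mem_univ _⟩
    rintro rfl
    have := hl.split.1.left_mem
    have h1 := hc y
    rw [← List.count_pos_iff] at this
    rw [show l₁ ++ x :: y :: l₂ = (l₁ ++ [x]) ++ (y :: l₂) by simp, List.count_append,
      List.count_cons_self] at h1
    omega
  · rw [card_erase_of_mem (mem_univ _), card_univ]
    have h1 := hdeg a
    have h2 := hdeg b
    have h4 := SimpleGraph.degree_le_of_le (v := a) hGG'
    have h5 := SimpleGraph.degree_le_of_le (v := b) hGG'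
    omega

variable {k m : ℕ}

/-- The complete multipartite graph whose parts are the classes of `c`. -/
def completePartite (c : V → Fin k) : SimpleGraph V where
  Adj u v := c u ≠ c v
  symm := ⟨fun _ _ h => h.symm⟩
  loopless := ⟨fun _ h => h rfl⟩

theorem hasSpanningCycle_completePartite {c : V → Fin k} (hm : ∀ i, #{v | c v = i} = m)
    (hk : 2 ≤ k) (h3 : 3 ≤ Fintype.card V) : HasSpanningCycle (completePartite c) := by
  classical
  refine hasSpanningCycle_of_card_le h3 fun v => ?_
  have hn := card_eq_mul_of_classes hm
  have : (completePartite c).neighborFinset v = univ \ ({u | c u = c v} : Finset V) := by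
    ext u
    rw [SimpleGraph.mem_neighborFinset]
    simp [completePartite, eq_comm]
  rw [← SimpleGraph.card_neighborFinset_eq_degree, this,
    Finset.card_sdiff_of_subset (subset_univ _),
    hm, card_univ]
  have : 2 * m ≤ k * m := Nat.mul_le_mul_right _ hk
  omega

/-- The theorem of Moon and Moser. -/
theorem hasSpanningCycle_of_bipartite {c : V → Fin 2} (hm : ∀ i, #{v | c v = i} = m)
    (hcol : ∀ u v, G.Adj u v → c u ≠ c v) (h3 : 3 ≤ Fintype.card V)
    (hdeg : ∀ v, m < 2 * G.degree v) : HasSpanningCycle G := by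
  classical
  by_contra hG
  obtain ⟨G', hGG', hG'K, hG', a, b, l, hl, hba, hc⟩ :=
    exists_le_isPathList (K := completePartite c) (fun u v h => hcol u v h) hG
      (hasSpanningCycle_completePartite hm le_rfl h3) h3
  have two : ∀ i j k : Fin 2, i ≠ j → j ≠ k → i = k := by decide
  refine hG' (hl.hasSpanningCycle_of_card_lt hc ({v | c v = c b} : Finset V) ?_ ?_ ?_)
  · intro x hx
    rw [SimpleGraph.mem_neighborFinset] at hx
    simpa using two _ _ _ (hG'K hx).symm (Ne.symm hba)
  · rintro x y l₁ l₂ rfl hbx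
    simpa using two _ _ _ (hG'K hl.split.2.2).symm (hG'K hbx).symm
  · rw [hm]
    have h1 := hdeg a
    have h2 := hdeg b
    have h4 := SimpleGraph.degree_le_of_le (v := a) hGG'
    have h5 := SimpleGraph.degree_le_of_le (v := b) hGG'
    omega

end Maximal

/-! ### Spanning cycle-path pairs with a shortest path -/

section Cover

variable {V : Type*} [DecidableEq V] {G : SimpleGraph V}

/-- `C` is the vertex list of a cycle of `G`, and `R` that of a path through all remaining vertices,
whose first vertex (if there is any) has a neighbour on the cycle. The degenerate cycle consisting
of a single edge is allowed. -/
structure IsCover (G : SimpleGraph V) (C R : List V) : Prop where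
  cycle : ∃ c d, IsPathList G c d C ∧ G.Adj d c
  chain : R.IsChain G.Adj
  link : ∀ a ∈ R.head?, ∃ x ∈ C, G.Adj x a
  count : ∀ v, C.count v + R.count v = 1

/-- The cycle `σ` with vertex set `S` misses exactly the vertices of the nonempty path `R`, and no
cover has a shorter path than `R`. -/
structure IsExtremal (G : SimpleGraph V) (S : Finset V) (σ : Equiv.Perm V) (R : List V) :
    Prop where
  cyc : IsCyclePerm G S σ
  chain : R.IsChain G.Adj
  ne_nil : R ≠ []
  count : ∀ v, (if v ∈ S then 1 else 0) + R.count v = 1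
  le_length : ∀ C' R', IsCover G C' R' → R.length ≤ R'.length

/-- A spanning path yields a cover, and hence an extremal pair. -/
theorem exists_isExtremal {a b : V} {l : List V} (hl : IsPathList G a b l)
    (hc : ∀ v, l.count v = 1) (h2 : 2 ≤ l.length) (hG : ¬ HasSpanningCycle G) :
    ∃ S σ R, IsExtremal G S σ R ∧ ∀ a ∈ R.head?, ∃ x ∈ S, G.Adj x a := by
  classical
  have hex : ∃ n, ∃ C R, IsCover G C R ∧ R.length = n := by
    match l, h2 with
    | x :: y :: l, _ =>
      obtain ⟨-, h3, h4⟩ := IsPathList.split (l₁ := []) hl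
      refine ⟨_, [x, y], l, ⟨⟨x, y, ⟨by simpa using h4, rfl, rfl⟩, h4.symm⟩, ?_, ?_, ?_⟩, rfl⟩
      · exact h3.chain.of_cons
      · intro z hz
        have := h3.chain
        rw [List.isChain_cons] at this
        exact ⟨y, by simp, this.1 z hz⟩
      · intro v; rw [← hc v]; simp [List.count_cons]; omega
  obtain ⟨C, R, hCR, hR⟩ := Nat.find_spec hex
  obtain ⟨c, d, hC, hdc⟩ := hCR.cycle
  have hnd : C.Nodup := List.nodup_iff_count_le_one.2 fun v => by have := hCR.count v; omega
  have hmem : ∀ v, (if v ∈ C then 1 else 0) = C.count v := fun v => (hnd.count).symm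
  refine ⟨C.toFinset, C.formPerm, R, ⟨hC.exists_isCyclePerm hdc hnd, hCR.chain, ?_, ?_, ?_⟩, ?_⟩
  · rintro rfl
    exact hG (.of_path hC hdc fun v => by simpa using hCR.count v)
  · intro v; simp only [List.mem_toFinset]; rw [hmem]; exact hCR.count v
  · intro C' R' h'
    rw [hR]
    exact Nat.find_min' hex ⟨C', R', h', rfl⟩
  · simpa using hCR.link

namespace IsExtremal

variable {S : Finset V} {σ : Equiv.Perm V} {R : List V}

/-- The path may be replaced by another one through the same vertices. -/
theorem of_count (h : IsExtremal G S σ R) {R' : List V} (hR' : R'.IsChain G.Adj)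
    (hc : ∀ v, R'.count v = R.count v) : IsExtremal G S σ R' := by
  have hp : R'.Perm R := List.perm_iff_count.2 hc
  refine ⟨h.cyc, hR', ?_, fun v => by rw [hc]; exact h.count v, ?_⟩
  · rintro rfl
    exact h.ne_nil (List.nil_perm.1 hp)
  · rw [hp.length_eq]; exact h.le_length

theorem reverse (h : IsExtremal G S σ R) : IsExtremal G S σ R.reverse :=
  h.of_count (by
    rw [List.isChain_reverse]; exact h.chain.imp fun _ _ hxy => hxy.symm) (by simp)

theorem mem_iff (h : IsExtremal G S σ R) {v : V} : v ∈ R ↔ v ∉ S := by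
  have := h.count v
  rw [← List.count_pos_iff]
  by_cases hv : v ∈ S
  · rw [if_pos hv] at this; simp only [hv, not_true_eq_false, iff_false]; omega
  · rw [if_neg hv] at this; simp only [hv, not_false_eq_true, iff_true]; omega

theorem nodup (h : IsExtremal G S σ R) : R.Nodup :=
  List.nodup_iff_count_le_one.2 fun v => by have := h.count v; omega

theorem length_add_card [Fintype V] (h : IsExtremal G S σ R) :
    R.length + #S = Fintype.card V := by
  rw [← List.toFinset_card_of_nodup h.nodup, ← Finset.card_compl_add_card S]
  congr 2
  ext v; simp [h.mem_iff]

variable {a b : V}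

/-- An end of the path has no two consecutive neighbours on the cycle. -/
theorem not_adj_apply (h : IsExtremal G S σ R) (hR : IsPathList G a b R) {x : V} (hx : x ∈ S)
    (hxa : G.Adj a x) : ¬ G.Adj a (σ x) := by
  intro hxa'
  obtain ⟨A, hA, hAc⟩ := h.cyc.cut_one (h.cyc.apply_mem.2 hx)
  have hA' := h.cyc.isPathList hA (h.cyc.apply_mem.2 hx)
  rw [show σ⁻¹ (σ x) = x by simp] at hA'
  obtain ⟨R', rfl⟩ : ∃ R', R = a :: R' := by
    have := hR.head
    cases R with
    | nil => simp at this
    | cons y R => simp at this; exact ⟨R, by rw [this]⟩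
  have hch := h.chain
  rw [List.isChain_cons] at hch
  have := h.le_length (a :: A) R' ⟨⟨a, x, hA'.cons hxa', hxa.symm⟩, hch.2,
    fun y hy => ⟨a, by simp, hch.1 y hy⟩, fun v => by
      rw [← h.count v, ← hAc v]; simp [List.count_cons]; omega⟩
  simp at this

/-- Neighbours on the cycle of the two ends of the path are far apart. -/
theorem length_lt_of_adj (h : IsExtremal G S σ R) (hR : IsPathList G a b R) {x : V} {k : ℕ}
    (hx : x ∈ S) (hxa : G.Adj a x) (hk : 1 ≤ k) (hkS : k ≤ #S) (hxb : G.Adj b ((σ ^ k) x)) :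
    R.length < k := by
  obtain ⟨k, rfl⟩ := Nat.exists_eq_add_of_le' hk
  obtain ⟨j, hj⟩ := Nat.exists_eq_add_of_le hkS
  have hy : (σ ^ (k + 1)) x ∈ S := h.cyc.pow_mem _ hx
  have hA := h.cyc.isPathList (arcList_arc j ((σ ^ (k + 1)) x)) hy
  have e : (σ ^ j) ((σ ^ (k + 1)) x) = x := by
    rw [← Equiv.Perm.mul_apply, ← pow_add, add_comm, ← hj]
    exact h.cyc.cyc.pow_card_apply hx
  rw [e] at hA
  have hx' : σ x ∈ S := h.cyc.apply_mem.2 hx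
  have := h.le_length (R ++ arc σ ((σ ^ (k + 1)) x) (j + 1)) (arc σ (σ x) k)
    ⟨⟨a, x, hR.append hA hxb, hxa.symm⟩, h.cyc.isChain_arc hx' k, ?_, ?_⟩
  · rw [arc_length] at this; omega
  · intro y hy
    refine ⟨x, List.mem_append_right _ hA.right_mem, ?_⟩
    cases k with
    | zero => simp [arc] at hy
    | succ k =>
      rw [arc_succ] at hy; simp at hy; rw [← hy]
      exact h.cyc.adj x hx
  · intro v
    have h1 := h.cyc.count_arc hx' v
    have e2 : #S = k + (j + 1) := by omega
    rw [e2, arc_add, ← Equiv.Perm.mul_apply, ← pow_succ, List.count_append] at h1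
    have h2 := h.count v
    rw [List.count_append]; omega

/-- A path that starts at a neighbour of an end of `R` and runs through all vertices of the cycle
ends in a vertex with no neighbours on `R`. -/
theorem not_adj_of_path (h : IsExtremal G S σ R) (hR : IsPathList G a b R) {x d : V} {D : List V}
    (hD : IsPathList G x d D) (hDc : ∀ v, D.count v = if v ∈ S then 1 else 0) (hxa : G.Adj a x)
    {y : V} (hy : y ∈ R) : ¬ G.Adj d y := by
  intro hdy
  obtain ⟨R₁, R₂, rfl⟩ := List.append_of_mem hy
  have e : R₁ ++ y :: R₂ = (R₁ ++ [y]) ++ R₂ := by simp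
  have hch := h.chain
  rw [e, List.isChain_append] at hch
  have hR1 : IsPathList G a y (R₁ ++ [y]) := by
    refine ⟨hch.1, ?_, by simp⟩
    have := hR.head
    cases R₁ <;> simpa using this
  have := h.le_length (D ++ (R₁ ++ [y]).reverse) R₂
    ⟨⟨x, a, hD.append hR1.reverse hdy, hxa⟩, hch.2.1, ?_, ?_⟩
  · simp at this; omega
  · intro z hz
    exact ⟨y, by simp, hch.2.2 y (by simp) z hz⟩
  · intro v
    have h1 := h.count v
    have h2 := hDc v
    rw [e, List.count_append] at h1
    rw [List.count_append, List.count_reverse]; omega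

end IsExtremal

end Cover

/-! ### The ends of a shortest path -/

section Ends

variable {V : Type*} [DecidableEq V] [Fintype V] {G : SimpleGraph V} [DecidableRel G.Adj]

namespace IsExtremal

variable {S : Finset V} {σ : Equiv.Perm V} {R : List V} {a b : V}

theorem degree_lt (h : IsExtremal G S σ R) (hR : IsPathList G a b R) :
    G.degree a < #{x ∈ S | G.Adj a x} + R.length := by
  have hsub : G.neighborFinset a ⊆ {x ∈ S | G.Adj a x} ∪ R.toFinset.erase a := by
    intro v hv
    rw [SimpleGraph.mem_neighborFinset] at hv
    by_cases hvS : v ∈ S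
    · simp [hvS, hv]
    · simp [hvS, hv.ne', h.mem_iff]
  have h1 := (Finset.card_le_card hsub).trans (Finset.card_union_le _ _)
  rw [SimpleGraph.card_neighborFinset_eq_degree,
    Finset.card_erase_of_mem (List.mem_toFinset.2 hR.left_mem),
    List.toFinset_card_of_nodup h.nodup] at h1
  have := List.length_pos_iff.2 h.ne_nil
  omega

/-- If both ends of the path `R` have neighbours on the cycle, not just a common one, then the
minimum degree is small: going around the cycle, neighbours of the same end are at distance at
least two, while between a neighbour of one end and a neighbour of the other end there are at
least as many vertices as on `R`. -/
theorem degree_bound (h : IsExtremal G S σ R) (hR : IsPathList G a b R) (hL : 2 ≤ R.length)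
    {x y : V} (hx : x ∈ S) (hy : y ∈ S) (hxy : x ≠ y) (hax : G.Adj a x) (hby : G.Adj b y) {d : ℕ}
    (hda : d ≤ G.degree a) (hdb : d ≤ G.degree b) :
    3 * d ≤ Fintype.card V + 1 ∨ 12 * d + 7 ≤ 5 * Fintype.card V := by
  have hn := h.length_add_card
  have ha := h.degree_lt hR
  have hb := h.reverse.degree_lt hR.reverse
  rw [List.length_reverse] at hb
  set A : Finset V := {x ∈ S | G.Adj a x} with hA
  set B : Finset V := {x ∈ S | G.Adj b x} with hB
  have memA : ∀ {u}, u ∈ A ↔ u ∈ S ∧ G.Adj a u := by simp [hA]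
  have memB : ∀ {u}, u ∈ B ↔ u ∈ S ∧ G.Adj b u := by simp [hB]
  have consA : ∀ u ∈ A, σ u ∉ A := fun u hu hu' =>
    h.not_adj_apply hR (memA.1 hu).1 (memA.1 hu).2 (memA.1 hu').2
  have consB : ∀ u ∈ B, σ u ∉ B := fun u hu hu' =>
    h.reverse.not_adj_apply hR.reverse (memB.1 hu).1 (memB.1 hu).2 (memB.1 hu').2
  have sep : ∀ w ∈ B, ∀ k, 1 ≤ k → k ≤ #S → (σ ^ k) w ∈ A → R.length < k := by
    intro w hw k hk hkS hu
    have := h.reverse.length_lt_of_adj hR.reverse (memB.1 hw).1 (memB.1 hw).2 hk hkS (memA.1 hu).2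
    rwa [List.length_reverse] at this
  have sep' : ∀ w ∈ A, ∀ k, 1 ≤ k → k ≤ #S → (σ ^ k) w ∈ B → R.length < k := by
    intro w hw k hk hkS hu
    exact h.length_lt_of_adj hR (memA.1 hw).1 (memA.1 hw).2 hk hkS (memB.1 hu).2
  have hxA : x ∈ A := memA.2 ⟨hx, hax⟩
  have hyB : y ∈ B := memB.2 ⟨hy, hby⟩
  -- the two arcs between `x` and `y` have at least `R.length` inner vertices each
  obtain ⟨k, hkS, hk⟩ := h.cyc.cyc.exists_pow_eq hx hy
  have hk0 : k ≠ 0 := by rintro rfl; exact hxy (by simpa using hk)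
  have h1 := sep' x hxA k (by omega) hkS.le (by rwa [hk])
  have hk' : (σ ^ (#S - k)) y = x := by
    rw [← hk, ← Equiv.Perm.mul_apply, ← pow_add, Nat.sub_add_cancel hkS.le]
    exact h.cyc.cyc.pow_card_apply hx
  have h2 := sep y hyB (#S - k) (by omega) (by omega) (by rwa [hk'])
  have memS : ∀ {u}, (u ∈ A ∨ u ∈ B) → u ∈ S := by
    rintro u (hu | hu)
    · exact (memA.1 hu).1
    · exact (memB.1 hu).1
  -- the last neighbour `w` of `b` before `x`
  have hex : ∃ i, 1 ≤ i ∧ (σ⁻¹ ^ i) x ∈ B :=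
    ⟨#S - k, by omega, by rw [← hk', inv_pow]; simpa using hyB⟩
  obtain ⟨i, ⟨hi1, hiB⟩, himin⟩ : ∃ i, (1 ≤ i ∧ (σ⁻¹ ^ i) x ∈ B) ∧
      ∀ j, 1 ≤ j → j < i → (σ⁻¹ ^ j) x ∉ B :=
    ⟨Nat.find hex, Nat.find_spec hex, fun j hj hji hjB => Nat.find_min hex hji ⟨hj, hjB⟩⟩
  have hiS : i ≤ #S - k := by
    by_contra! hcon
    exact himin (#S - k) (by omega) hcon (by rw [← hk', inv_pow]; simpa using hyB)
  set w := (σ⁻¹ ^ i) x with hw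
  have hshift : ∀ t, t ≤ i → (σ ^ t) w = (σ⁻¹ ^ (i - t)) x := by
    intro t ht
    rw [hw]
    conv_lhs => rw [← Nat.add_sub_cancel' ht, pow_add, Equiv.Perm.mul_apply, inv_pow]
    simp
  have hiL : R.length < i := sep w hiB i hi1 (by omega) (by rw [hshift i le_rfl]; simpa using hxA)
  have hwB : ∀ t, 1 ≤ t → t ≤ R.length → (σ ^ t) w ∉ B := by
    intro t ht htL
    rw [hshift t (by omega)]
    exact himin _ (by omega) (by omega)
  -- `A`, `σ A`, `σ² B` are disjoint, and so are `σ³ B` and the vertices `σ⁴ w, …` if `3 ≤ R.length`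
  have cσ : ∀ (X : Finset V) (j : ℕ), #(X.image (σ ^ j : Equiv.Perm V)) = #X := fun X j =>
    Finset.card_image_of_injective _ (Equiv.injective _)
  have hw4 : #((Finset.Ico 4 (R.length + 1)).image fun t => (σ ^ t) w) = R.length - 3 := by
    rw [Finset.card_image_of_injOn, Nat.card_Ico]
    · omega
    · intro s hs t ht hst
      simp only [Finset.coe_Ico, Set.mem_Ico] at hs ht
      simp only at hst
      rw [h.cyc.cyc.pow_apply_eq_pow_apply (memS (.inr hiB))] at hst
      exact Nat.ModEq.eq_of_lt_of_lt hst (by omega) (by omega)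
  have hA2 : Disjoint A (A.image (σ ^ 1 : Equiv.Perm V)) := by
    rw [Finset.disjoint_left]
    intro u hu hu'
    obtain ⟨v, hv, rfl⟩ := Finset.mem_image.1 hu'
    exact consA v hv hu
  have key : ∀ j t, ∀ v ∈ B, j ≤ t → (σ ^ t) v ∈ A.image (σ ^ j : Equiv.Perm V) →
      (σ ^ (t - j)) v ∈ A := by
    intro j t v hv hjt hu
    obtain ⟨u, hu, hvu⟩ := Finset.mem_image.1 hu
    have : (σ ^ j) ((σ ^ (t - j)) v) = (σ ^ j) u := by
      rw [hvu, ← Equiv.Perm.mul_apply, ← pow_add, Nat.add_sub_cancel' hjt]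
    rwa [(σ ^ j).injective this]
  have hAB : ∀ j t, j + 1 ≤ t → t ≤ R.length + j →
      Disjoint (A.image (σ ^ j : Equiv.Perm V)) (B.image (σ ^ t : Equiv.Perm V)) := by
    intro j t hjt htL
    rw [Finset.disjoint_right]
    intro u hu hu'
    obtain ⟨v, hv, rfl⟩ := Finset.mem_image.1 hu
    have := sep v hv (t - j) (by omega) (by omega) (key j t v hv (by omega) hu')
    omega
  have hAw : ∀ j, j ≤ 1 → Disjoint (A.image (σ ^ j : Equiv.Perm V))
      ((Finset.Ico 4 (R.length + 1)).image fun t => (σ ^ t) w) := by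
    intro j hj
    rw [Finset.disjoint_right]
    intro u hu hu'
    obtain ⟨t, ht, rfl⟩ := Finset.mem_image.1 hu
    rw [Finset.mem_Ico] at ht
    have := sep w hiB (t - j) (by omega) (by omega) (key j t w hiB (by omega) hu')
    omega
  have hBw : ∀ j, 2 ≤ j → j ≤ 3 → Disjoint (B.image (σ ^ j : Equiv.Perm V))
      ((Finset.Ico 4 (R.length + 1)).image fun t => (σ ^ t) w) := by
    intro j hj hj3
    rw [Finset.disjoint_right]
    intro u hu hu'
    obtain ⟨t, ht, rfl⟩ := Finset.mem_image.1 hu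
    rw [Finset.mem_Ico] at ht
    obtain ⟨u, hu, hvu⟩ := Finset.mem_image.1 hu'
    have : (σ ^ j) ((σ ^ (t - j)) w) = (σ ^ j) u := by
      rw [hvu, ← Equiv.Perm.mul_apply, ← pow_add, Nat.add_sub_cancel' (by omega)]
    have := (σ ^ j).injective this
    exact hwB (t - j) (by omega) (by omega) (by rwa [this])
  have hBB : Disjoint (B.image (σ ^ 2 : Equiv.Perm V)) (B.image (σ ^ 3 : Equiv.Perm V)) := by
    rw [Finset.disjoint_left]
    intro u hu hu'
    obtain ⟨v, hv, rfl⟩ := Finset.mem_image.1 hu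
    obtain ⟨v', hv', hvv⟩ := Finset.mem_image.1 hu'
    have : (σ ^ 2) (σ v') = (σ ^ 2) v := by
      rw [← hvv, ← Equiv.Perm.mul_apply, ← pow_succ]
    exact consB v' hv' (by rwa [(σ ^ 2).injective this])
  have e0 : A.image (σ ^ 0 : Equiv.Perm V) = A := by ext; simp
  have imS : ∀ (X : Finset V) (j : ℕ), X ⊆ S → X.image (σ ^ j : Equiv.Perm V) ⊆ S := by
    intro X j hX u hu
    obtain ⟨v, hv, rfl⟩ := Finset.mem_image.1 hu
    exact h.cyc.pow_mem j (hX hv)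
  have hAS : A ⊆ S := fun u hu => memS (.inl hu)
  have hBS : B ⊆ S := fun u hu => memS (.inr hu)
  rcases Nat.lt_or_ge R.length 3 with hL3 | hL3
  · left
    have d1 := hAB 0 2 (by omega) (by omega)
    have d2 := hAB 1 2 (by omega) (by omega)
    rw [e0] at d1
    have hu := Finset.card_union_of_disjoint hA2
    have hu2 := Finset.card_union_of_disjoint (Finset.disjoint_union_left.2 ⟨d1, d2⟩)
    have hle := Finset.card_le_card (Finset.union_subset
      (Finset.union_subset hAS (imS A 1 hAS)) (imS B 2 hBS))
    rw [cσ] at hu hu2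
    omega
  · right
    have d1 := hAB 0 2 (by omega) (by omega)
    have d2 := hAB 1 2 (by omega) (by omega)
    have d3 := hAB 0 3 (by omega) (by omega)
    have d4 := hAB 1 3 (by omega) (by omega)
    have d5 := hAw 0 (by omega)
    have d6 := hAw 1 (by omega)
    have d7 := hBw 2 (by omega) (by omega)
    have d8 := hBw 3 (by omega) (by omega)
    rw [e0] at d1 d3 d5
    have hwS : ((Finset.Ico 4 (R.length + 1)).image fun t => (σ ^ t) w) ⊆ S := by
      intro u hu
      obtain ⟨t, -, rfl⟩ := Finset.mem_image.1 hu
      exact h.cyc.pow_mem t (hBS hiB)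
    have c1 := Finset.card_union_of_disjoint hA2
    have c2 := Finset.card_union_of_disjoint (Finset.disjoint_union_left.2 ⟨d1, d2⟩)
    have c3 := Finset.card_union_of_disjoint
      (Finset.disjoint_union_left.2 ⟨Finset.disjoint_union_left.2 ⟨d3, d4⟩, hBB⟩)
    have c4 := Finset.card_union_of_disjoint (Finset.disjoint_union_left.2
      ⟨Finset.disjoint_union_left.2 ⟨Finset.disjoint_union_left.2 ⟨d5, d6⟩, d7⟩, d8⟩)
    have hle := Finset.card_le_card (Finset.union_subset (Finset.union_subset (Finset.union_subset
      (Finset.union_subset hAS (imS A 1 hAS)) (imS B 2 hBS)) (imS B 3 hBS)) hwS)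
    rw [cσ] at c1 c2 c3
    rw [hw4] at c4
    omega

end IsExtremal

end Ends

/-! ### The shortest path is a single vertex -/

section Connectivity

variable {V : Type*} [DecidableEq V] [Fintype V] {G : SimpleGraph V} [DecidableRel G.Adj]

/-- If all neighbours of the vertices of `U` lie in `P ⊇ U`, then each colour class meeting `U` has
at most `#P - d` vertices in `P`, where `d` is a lower bound for the degrees. So `U` is small, or
`P` is covered by these classes. -/
theorem card_le_mul_of_adj_mem {k d q : ℕ} {c : V → Fin k} (hk : 1 ≤ k)
    (hcol : ∀ u v, G.Adj u v → c u ≠ c v) (hdeg : ∀ v, d ≤ G.degree v) {P U : Finset V}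
    (hUP : U ⊆ P) (hN : ∀ u ∈ U, ∀ x, G.Adj u x → x ∈ P) (hqU : q ≤ #U) (hqd : q ≤ d) :
    q ≤ (k - 1) * (#P - d) := by
  have hcl : ∀ u ∈ U, d + #{x ∈ P | c x = c u} ≤ #P := by
    intro u hu
    have hsub : G.neighborFinset u ⊆ P \ {x ∈ P | c x = c u} := by
      intro x hx
      rw [SimpleGraph.mem_neighborFinset] at hx
      simp only [mem_sdiff, mem_filter, not_and]
      exact ⟨hN u hu x hx, fun _ hc => hcol u x hx hc.symm⟩
    have h1 := Finset.card_le_card hsub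
    rw [SimpleGraph.card_neighborFinset_eq_degree, Finset.card_sdiff_of_subset (filter_subset _ _)]
      at h1
    have h2 := Finset.card_le_card (filter_subset (fun x => c x = c u) P)
    have h3 := hdeg u
    have h4 : 0 < #{x ∈ P | c x = c u} := Finset.card_pos.2 ⟨u, by simp [hUP hu]⟩
    omega
  by_cases hall : ∀ i, ∃ u ∈ U, c u = i
  · obtain ⟨u, hu, -⟩ := hall ⟨0, hk⟩
    have h1 : #P ≤ (#P - d) * #(Finset.univ : Finset (Fin k)) := by
      refine Finset.card_le_mul_card_image_of_maps_to (f := c) (by simp) _ ?_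
      intro i _
      obtain ⟨u, hu, rfl⟩ := hall i
      have := hcl u hu; omega
    rw [card_univ, Fintype.card_fin] at h1
    have h2 := hcl u hu
    obtain ⟨j, rfl⟩ := Nat.exists_eq_add_of_le' hk
    obtain ⟨t, ht⟩ := Nat.exists_eq_add_of_le (show d ≤ #P by omega)
    rw [ht, Nat.add_sub_cancel_left] at h1 ⊢
    rw [Nat.add_sub_cancel]
    nlinarith
  · push Not at hall
    obtain ⟨i, hi⟩ := hall
    have h1 : #U ≤ (#P - d) * #((univ : Finset (Fin k)).erase i) := by
      refine Finset.card_le_mul_card_image_of_maps_to (f := c) ?_ _ ?_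
      · intro u hu; simpa using hi u hu
      · intro j _
        rcases Finset.eq_empty_or_nonempty {u ∈ U | c u = j} with h0 | ⟨u, hu⟩
        · rw [h0]; simp
        · obtain ⟨hu', rfl⟩ := mem_filter.1 hu
          have h2 := hcl u hu'
          have h3 := Finset.card_le_card (filter_subset_filter (fun x => c x = c u) hUP)
          omega
    rw [card_erase_of_mem (mem_univ _), card_univ, Fintype.card_fin, mul_comm] at h1
    omega

namespace IsExtremal

variable {S : Finset V} {σ : Equiv.Perm V} {R : List V} {a b : V}

/-- At least `d` vertices of the cycle have no neighbours on the path. -/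
theorem exists_subset_cycle (h : IsExtremal G S σ R) (hR : IsPathList G a b R) {x : V} (hx : x ∈ S)
    (hax : G.Adj a x) {d : ℕ} (hdeg : ∀ v, d ≤ G.degree v) :
    ∃ W ⊆ S, d ≤ #W ∧ ∀ w ∈ W, ∀ y, G.Adj w y → y ∈ S := by
  have hnot : ∀ D z, IsPathList G x z D → (∀ v, D.count v = if v ∈ S then 1 else 0) →
      z ∈ S ∧ ∀ y, G.Adj z y → y ∈ S := by
    intro D z hD hDc
    refine ⟨?_, fun y hzy => ?_⟩
    · by_contra hz
      have h1 := hDc z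
      rw [if_neg hz, List.count_eq_zero] at h1
      exact h1 hD.right_mem
    · by_contra hy
      exact h.not_adj_of_path hR hD hDc hax (h.mem_iff.2 hy) hzy
  obtain ⟨A, hA, hAc⟩ := h.cyc.cut_one (h.cyc.apply_mem.2 hx)
  have hA' := (h.cyc.isPathList hA (h.cyc.apply_mem.2 hx)).reverse
  rw [show σ⁻¹ (σ x) = x by simp] at hA'
  have hAc' : ∀ v, A.reverse.count v = if v ∈ S then 1 else 0 := by simpa using hAc
  generalize A.reverse = D at hA' hAc'
  have hmemD : ∀ v, v ∈ S → v ∈ D := fun v hv => by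
    rw [← List.count_pos_iff, hAc', if_pos hv]; exact one_pos
  obtain ⟨W, hW, hW'⟩ := exists_successors (l := D)
    (List.nodup_iff_count_le_one.2 fun v => by rw [hAc']; split_ifs <;> omega)
    (G.neighborFinset (σ x))
    (fun y hy => hmemD y ((hnot D _ hA' hAc').2 y (by simpa using hy)))
    (by intro z hz; rw [hA'.last] at hz; simp at hz; subst hz; simp)
  have hW'' : ∀ w ∈ W, w ∈ S ∧ ∀ y, G.Adj w y → y ∈ S := by
    intro w hw
    obtain ⟨l₁, z, l₂, rfl, hz⟩ := hW' w hw
    rw [SimpleGraph.mem_neighborFinset] at hz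
    obtain ⟨h1, h2, -⟩ := hA'.split
    refine hnot _ w (h1.append h2.reverse hz.symm) fun v => ?_
    rw [← hAc' v]; simp [List.count_cons, List.count_append]
  refine ⟨W, fun w hw => (hW'' w hw).1, ?_, fun w hw => (hW'' w hw).2⟩
  rw [hW, SimpleGraph.card_neighborFinset_eq_degree]; exact hdeg _

/-- If only `x` on the cycle can be adjacent to the end of a path through the vertices of `R`
starting at `a`, then at least `d - 1` vertices of `R` have all their neighbours in `R ∪ {x}`. -/
theorem exists_subset_path (h : IsExtremal G S σ R) (hR : IsPathList G a b R) {x : V}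
    (hend : ∀ R' z, IsExtremal G S σ R' → R'.length = R.length → IsPathList G a z R' →
      ∀ y ∈ S, G.Adj z y → y = x)
    {d : ℕ} (hdeg : ∀ v, d ≤ G.degree v) :
    ∃ U ⊆ R.toFinset, d ≤ #U + 1 ∧ ∀ u ∈ U, ∀ y, G.Adj u y → y ∈ insert x R.toFinset := by
  have hnot : ∀ R' z, IsExtremal G S σ R' → R'.length = R.length → IsPathList G a z R' →
      ∀ y, G.Adj z y → y ∈ insert x R.toFinset := by
    intro R' z hR' hlen hp y hzy
    by_cases hy : y ∈ S
    · simp [hend R' z hR' hlen hp y hy hzy]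
    · simp [h.mem_iff, hy]
  obtain ⟨U, hU, hU'⟩ := exists_successors h.nodup ((G.neighborFinset b).erase x ∩ R.toFinset)
    (fun y hy => by simp at hy; exact hy.2.2)
    (by intro z hz; rw [hR.last] at hz; simp at hz; subst hz; simp)
  refine ⟨U, ?_, ?_, ?_⟩
  · intro u hu
    obtain ⟨l₁, z, l₂, rfl, -⟩ := hU' u hu
    simp
  · rw [hU, Finset.inter_eq_left.2]
    · have := Finset.pred_card_le_card_erase (s := G.neighborFinset b) (a := x)
      rw [SimpleGraph.card_neighborFinset_eq_degree] at this
      have := hdeg b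
      omega
    · intro y hy
      obtain ⟨hyx, hy⟩ := mem_erase.1 hy
      exact (mem_insert.1 (hnot R b h rfl hR y (by simpa using hy))).resolve_left hyx
  · intro u hu
    obtain ⟨l₁, z, l₂, e, hz⟩ := hU' u hu
    have hz' : G.Adj b z := by simp at hz; exact hz.2.1
    have hR2 := hR
    rw [e] at hR2
    obtain ⟨h1, h2, -⟩ := hR2.split
    have hp := h1.append h2.reverse hz'.symm
    have hcnt : ∀ v, ((l₁ ++ [z]) ++ (u :: l₂).reverse).count v = R.count v := by
      intro v; rw [e]; simp [List.count_cons, List.count_append]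
    exact hnot _ u (h.of_count hp.chain hcnt) (List.perm_iff_count.2 hcnt).length_eq hp

/-- Under the degree condition, the extremal path is a single vertex. Otherwise the cycle and the
path are joined through one vertex only, and the smaller of these two sides would have to be
covered by too few vertices of each colour class. -/
theorem length_eq_one (h : IsExtremal G S σ R) (hlink : ∀ a ∈ R.head?, ∃ x ∈ S, G.Adj x a)
    {k d e : ℕ} {c : V → Fin k} (hk : 1 ≤ k) (hcol : ∀ u v, G.Adj u v → c u ≠ c v)
    (hdeg : ∀ v, d ≤ G.degree v) (h1 : Fintype.card V + 1 < 3 * d)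
    (h2 : 5 * Fintype.card V < 12 * d + 7) (h3 : Fintype.card V ≤ 2 * d + 2 * e)
    (h4 : (k - 1) * e + 1 < d) : R.length = 1 := by
  by_contra hne
  have hL : 2 ≤ R.length := by
    have := List.length_pos_iff.2 h.ne_nil
    omega
  obtain ⟨a, b, hR⟩ := isPathList_of_isChain h.chain h.ne_nil
  obtain ⟨x, hx, hxa⟩ := hlink a (by rw [hR.head]; rfl)
  have hend : ∀ R' z, IsExtremal G S σ R' → R'.length = R.length → IsPathList G a z R' →
      ∀ y ∈ S, G.Adj z y → y = x := by
    intro R' z hR' hlen hp y hy hzy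
    by_contra hyx
    have := hR'.degree_bound hp (by omega) hx hy (Ne.symm hyx) hxa.symm hzy (hdeg a) (hdeg z)
    omega
  obtain ⟨W, hWS, hWd, hWN⟩ := h.exists_subset_cycle hR hx hxa.symm hdeg
  obtain ⟨U, hUR, hUd, hUN⟩ := h.exists_subset_path hR hend hdeg
  have hWc := card_le_mul_of_adj_mem hk hcol hdeg hWS hWN hWd le_rfl
  have hUc := card_le_mul_of_adj_mem (q := d - 1) hk hcol hdeg
    (hUR.trans (Finset.subset_insert x _)) hUN (by omega) (by omega)
  rw [Finset.card_insert_of_notMem (by simp [h.mem_iff, hx]),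
    List.toFinset_card_of_nodup h.nodup] at hUc
  have hn := h.length_add_card
  rcases Nat.lt_or_ge e (#S - d) with hS | hS
  · have := Nat.mul_le_mul_left (k - 1) (show R.length + 1 - d ≤ e by omega)
    omega
  · have := Nat.mul_le_mul_left (k - 1) hS
    omega

end IsExtremal

end Connectivity

/-! ### Exchanges on a cycle that misses one vertex -/

section Exchange

variable {V : Type*} {G : SimpleGraph V}

/-- The vertex `y` is `w` or lies on the cycle between two neighbours of `w`, at distance one from
both. In the second case `w` and `y` can be exchanged. -/
def Exchangeable (G : SimpleGraph V) (w : V) (σ : Equiv.Perm V) (y : V) : Prop :=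
  y = w ∨ (G.Adj w (σ y) ∧ G.Adj w (σ⁻¹ y))

theorem Exchangeable.inv {w y : V} {σ : Equiv.Perm V} (h : Exchangeable G w σ y) :
    Exchangeable G w σ⁻¹ y := by
  rcases h with h | h
  · exact .inl h
  · exact .inr ⟨h.2, by simpa using h.1⟩

variable [DecidableEq V] [Fintype V]

/-- `σ` is a cycle of `G` through all vertices but `w`, and `G` has no spanning cycle. -/
structure MissesOne (G : SimpleGraph V) (w : V) (σ : Equiv.Perm V) : Prop where
  cyc : IsCyclePerm G (univ.erase w) σ
  not_spanning : ¬ HasSpanningCycle G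

namespace MissesOne

variable {w : V} {σ : Equiv.Perm V}

theorem inv (h : MissesOne G w σ) : MissesOne G w σ⁻¹ := ⟨h.cyc.inv, h.not_spanning⟩

theorem apply_ne (h : MissesOne G w σ) {x : V} : σ x ≠ w ↔ x ≠ w := by
  simpa using h.cyc.apply_mem (x := x)

theorem inv_apply_ne (h : MissesOne G w σ) {x : V} : σ⁻¹ x ≠ w ↔ x ≠ w := by
  simpa using h.cyc.inv_mem (x := x)

theorem adj_apply (h : MissesOne G w σ) {x : V} (hx : x ≠ w) : G.Adj x (σ x) :=
  h.cyc.adj x (by simp [hx])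

theorem adj_inv_apply (h : MissesOne G w σ) {x : V} (hx : x ≠ w) : G.Adj (σ⁻¹ x) x := by
  simpa using h.adj_apply (h.inv_apply_ne.2 hx)

theorem isPathList (h : MissesOne G w σ) {x e : V} {l : List V} (hl : ArcList σ x e l)
    (hx : x ≠ w) : IsPathList G x e l := h.cyc.isPathList hl (by simp [hx])

theorem count_aux {w v : V} : (if v ∈ univ.erase w then 1 else 0) + [w].count v = 1 := by
  by_cases h : v = w
  · simp [h]
  · simp [h, Ne.symm h]

theorem cut_one (h : MissesOne G w σ) {x : V} (hx : x ≠ w) :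
    ∃ A, ArcList σ x (σ⁻¹ x) A ∧ ∀ v, A.count v + [w].count v = 1 := by
  obtain ⟨A, hA, hc⟩ := h.cyc.cut_one (x := x) (by simp [hx])
  exact ⟨A, hA, fun v => by rw [hc, count_aux]⟩

theorem cut_two (h : MissesOne G w σ) {x y : V} (hx : x ≠ w) (hy : y ≠ w) (hxy : x ≠ y) :
    ∃ A B, ArcList σ x (σ⁻¹ y) A ∧ ArcList σ y (σ⁻¹ x) B ∧
      ∀ v, A.count v + B.count v + [w].count v = 1 := by
  obtain ⟨A, B, hA, hB, hc⟩ := h.cyc.cut_two (x := x) (y := y) (by simp [hx]) (by simp [hy]) hxy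
  exact ⟨A, B, hA, hB, fun v => by rw [hc, count_aux]⟩

theorem cut_three (h : MissesOne G w σ) {x y z : V} (hx : x ≠ w) (hy : y ≠ w) (hz : z ≠ w)
    (hxy : x ≠ y) (hxz : x ≠ z) (hyz : y ≠ z) :
    (∃ A B D, ArcList σ x (σ⁻¹ y) A ∧ ArcList σ y (σ⁻¹ z) B ∧ ArcList σ z (σ⁻¹ x) D ∧
      ∀ v, A.count v + B.count v + D.count v + [w].count v = 1) ∨
    (∃ A B D, ArcList σ x (σ⁻¹ z) A ∧ ArcList σ z (σ⁻¹ y) B ∧ ArcList σ y (σ⁻¹ x) D ∧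
      ∀ v, A.count v + B.count v + D.count v + [w].count v = 1) := by
  rcases h.cyc.cut_three (x := x) (y := y) (z := z) (by simp [hx]) (by simp [hy]) (by simp [hz])
    hxy hxz hyz with ⟨A, B, D, hA, hB, hD, hc⟩ | ⟨A, B, D, hA, hB, hD, hc⟩
  · exact .inl ⟨A, B, D, hA, hB, hD, fun v => by rw [hc, count_aux]⟩
  · exact .inr ⟨A, B, D, hA, hB, hD, fun v => by rw [hc, count_aux]⟩

theorem uncons (h : MissesOne G w σ) {x e : V} {l : List V} (hl : ArcList σ x e l) (hx : x ≠ w)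
    (hxe : x ≠ e) : ∃ l', l = [x] ++ l' ∧ IsPathList G (σ x) e l' := by
  obtain ⟨l', rfl, hl'⟩ := hl.uncons hxe
  exact ⟨l', rfl, h.isPathList hl' (h.apply_ne.2 hx)⟩

theorem not_adj_apply (h : MissesOne G w σ) {x : V} (hx : G.Adj w x) : ¬ G.Adj w (σ x) := by
  intro hx'
  obtain ⟨A, hA, hc⟩ := h.cut_one (h.apply_ne.2 hx.ne')
  have hA := h.isPathList hA (h.apply_ne.2 hx.ne')
  rw [show σ⁻¹ (σ x) = x by simp] at hA
  refine h.not_spanning (.of_path ((IsPathList.single w).append hA hx') hx.symm fun v => ?_)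
  have := hc v
  simp only [List.count_append]; omega

/-- The successors of two neighbours of `w` are not adjacent. -/
theorem not_adj_apply_apply (h : MissesOne G w σ) {x y : V} (hx : G.Adj w x) (hy : G.Adj w y) :
    ¬ G.Adj (σ x) (σ y) := by
  intro hxy
  obtain ⟨A, B, hA, hB, hc⟩ := h.cut_two (h.apply_ne.2 hx.ne') (h.apply_ne.2 hy.ne') hxy.ne
  have hA := h.isPathList hA (h.apply_ne.2 hx.ne')
  have hB := h.isPathList hB (h.apply_ne.2 hy.ne')
  rw [show σ⁻¹ (σ y) = y by simp] at hA
  rw [show σ⁻¹ (σ x) = x by simp] at hB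
  refine h.not_spanning (.of_path
    (((IsPathList.single w).append hA.reverse hy).append hB hxy) hx.symm fun v => ?_)
  have := hc v
  simp only [List.count_append, List.count_reverse]; omega

theorem not_adj_of_exchangeable (h : MissesOne G w σ) {y : V} (hy : Exchangeable G w σ y) :
    ¬ G.Adj w y := by
  rcases hy with rfl | hy
  · simp
  · simpa using h.not_adj_apply hy.2

theorem not_adj_exchangeable (h : MissesOne G w σ) {y y' : V} (hy : Exchangeable G w σ y)
    (hy' : Exchangeable G w σ y') : ¬ G.Adj y y' := by
  by_cases h1 : y = w
  · subst h1; exact h.not_adj_of_exchangeable hy'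
  by_cases h2 : y' = w
  · subst h2; exact fun hh => h.not_adj_of_exchangeable hy hh.symm
  have := h.not_adj_apply_apply (hy.resolve_left h1).2 (hy'.resolve_left h2).2
  simpa using this

theorem not_adj_apply_of_adj (h : MissesOne G w σ) {y b : V} (hy : Exchangeable G w σ y)
    (hb : G.Adj w b) : ¬ G.Adj y (σ b) := by
  intro hyb
  rcases eq_or_ne y w with rfl | hyw
  · exact h.not_adj_apply hb hyb
  have hyb' : y ≠ b := by rintro rfl; exact h.not_adj_of_exchangeable hy hb
  obtain ⟨h1, h2⟩ := hy.resolve_left hyw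
  obtain ⟨A, B, hA, hB, hc⟩ := h.cut_two (h.apply_ne.2 hb.ne') hyw hyb.ne'
  have hA := h.isPathList hA (h.apply_ne.2 hb.ne')
  have hB := h.isPathList hB hyw
  rw [show σ⁻¹ (σ b) = b by simp] at hB
  refine h.not_spanning (.of_path
    (((IsPathList.single w).append hB.reverse hb).append hA hyb) h2.symm fun v => ?_)
  have := hc v
  simp only [List.count_append, List.count_reverse]; omega

/-- Two consecutive vertices of the cycle cannot be neighbours of exchangeable vertices. This is a
single step of Woodall's hopping argument. -/
theorem not_adj_apply_of_exchangeable (h : MissesOne G w σ) {y y' b : V}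
    (hy : Exchangeable G w σ y) (hy' : Exchangeable G w σ y') (hb : G.Adj y b) :
    ¬ G.Adj y' (σ b) := by
  intro hb'
  rcases eq_or_ne y w with rfl | hyw
  · exact h.not_adj_apply_of_adj hy' hb hb'
  rcases eq_or_ne y' w with rfl | hyw'
  · exact h.inv.not_adj_apply_of_adj hy.inv hb' (by simpa using hb)
  have hbw : b ≠ w := by
    rintro rfl; exact h.not_adj_of_exchangeable hy hb.symm
  have hσb := h.apply_ne.2 hbw
  have e : σ⁻¹ (σ b) = b := by simp
  obtain ⟨h1, h2⟩ := hy.resolve_left hyw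
  obtain ⟨h1', h2'⟩ := hy'.resolve_left hyw'
  have hyb : y ≠ σ b := by
    rintro rfl; exact h.not_adj_exchangeable hy' hy hb'
  have hyb' : y' ≠ b := by
    rintro rfl; exact h.not_adj_exchangeable hy hy' hb
  rcases eq_or_ne y y' with rfl | hyy
  · obtain ⟨A, B, hA, hB, hc⟩ := h.cut_two hσb hyw hb'.ne'
    rw [e] at hB
    have hA := h.isPathList hA hσb
    obtain ⟨B, rfl, pB⟩ := h.uncons hB hyw hb.ne
    refine h.not_spanning (.of_path (((((IsPathList.single y).append hA hb').append
      (.single w) h2.symm).append pB h1)) hb.symm fun v => ?_)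
    have := hc v
    simp only [List.count_append] at this ⊢; omega
  rcases h.cut_three hσb hyw hyw' hyb.symm hb'.ne' hyy with
    ⟨A, B, D, hA, hB, hD, hc⟩ | ⟨A, B, D, hA, hB, hD, hc⟩
  · rw [e] at hD
    have hA := h.isPathList hA hσb
    have hB := h.isPathList hB hyw
    obtain ⟨D, rfl, pD⟩ := h.uncons hD hyw' hyb'
    refine h.not_spanning (.of_path ((((hB.append (.single y') (h.adj_inv_apply hyw')).append
      hA hb').append (.single w) h2.symm).append pD h1') hb.symm fun v => ?_)
    have := hc v
    simp only [List.count_append] at this ⊢; omega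
  · rw [e] at hD
    have hA := h.isPathList hA hσb
    have hB := h.isPathList hB hyw'
    obtain ⟨D, rfl, pD⟩ := h.uncons hD hyw hb.ne
    refine h.not_spanning (.of_path (((((IsPathList.single y).append hB.reverse
      (h.adj_inv_apply hyw).symm).append hA hb').append (.single w) h2'.symm).append pD h1)
      hb.symm fun v => ?_)
    have := hc v
    simp only [List.count_append, List.count_reverse] at this ⊢; omega

/-- The successors of a neighbour of `w` and of a neighbour of an exchangeable vertex are not
adjacent. -/
theorem not_adj_apply_apply_of_exchangeable (h : MissesOne G w σ) {x x' y : V} (hx : G.Adj w x)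
    (hy : Exchangeable G w σ y) (hx' : G.Adj y x') : ¬ G.Adj (σ x) (σ x') := by
  intro hxx
  by_cases hwx' : G.Adj w x'
  · exact h.not_adj_apply_apply hx hwx' hxx
  rcases eq_or_ne y w with rfl | hyw
  · exact hwx' hx'
  have hxw' : x' ≠ w := by
    rintro rfl; exact h.not_adj_of_exchangeable hy hx'.symm
  obtain ⟨h1, h2⟩ := hy.resolve_left hyw
  have hyx : y ≠ x := by rintro rfl; exact h.not_adj_of_exchangeable hy hx
  have hy1 : σ x ≠ y := by
    rintro rfl; exact h.not_adj_apply_of_exchangeable hy hy hx' hxx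
  have hy2 : σ x' ≠ y := by
    rintro rfl; exact hwx' (by simpa using h2)
  have hσx := h.apply_ne.2 hx.ne'
  have hσx' := h.apply_ne.2 hxw'
  have e : σ⁻¹ (σ x) = x := by simp
  have e' : σ⁻¹ (σ x') = x' := by simp
  rcases h.cut_three hσx hσx' hyw hxx.ne hy1 hy2 with
    ⟨A, B, D, hA, hB, hD, hc⟩ | ⟨A, B, D, hA, hB, hD, hc⟩
  · rw [e'] at hA; rw [e] at hD
    have hA := h.isPathList hA hσx
    have hB := h.isPathList hB hσx'
    have hD := h.isPathList hD hyw
    refine h.not_spanning (.of_path ((((IsPathList.single w).append hD.reverse hx).append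
      hA.reverse hx').append hB hxx) h2.symm fun v => ?_)
    have := hc v
    simp only [List.count_append, List.count_reverse] at this ⊢; omega
  · rw [e'] at hB; rw [e] at hD
    have hA := h.isPathList hA hσx
    have hD := h.isPathList hD hσx'
    obtain ⟨B, rfl, pB⟩ := h.uncons hB hyw hx'.ne
    refine h.not_spanning (.of_path (((((IsPathList.single w).append hD.reverse hx).append
      hA hxx.symm).append (.single y) (h.adj_inv_apply hyw)).append pB.reverse hx')
      h1.symm fun v => ?_)
    have := hc v
    simp only [List.count_append, List.count_reverse] at this ⊢; omega

/-- An exchange along two chords: `σ a` is the successor of a neighbour of `w`, while `z` and `z'`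
are predecessors of neighbours of `w`. -/
theorem not_adj_of_two_chords (h : MissesOne G w σ) {a z z' : V} (ha : G.Adj w a)
    (hz : G.Adj w (σ z)) (hz' : G.Adj w (σ z')) (hzz' : z ≠ z') (hza : G.Adj z (σ a))
    (hza' : G.Adj z' (σ a)) (hzb : G.Adj z (σ⁻¹ z')) : ¬ G.Adj z' (σ⁻¹ z) := by
  intro hzb'
  have hσa := h.apply_ne.2 ha.ne'
  have hzw := h.apply_ne.1 hz.ne'
  have hzw' := h.apply_ne.1 hz'.ne'
  have e : σ⁻¹ (σ a) = a := by simp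
  rcases h.cut_three hσa hzw hzw' hza.ne' hza'.ne' hzz' with
    ⟨A, B, D, hA, hB, hD, hc⟩ | ⟨A, B, D, hA, hB, hD, hc⟩
  · rw [e] at hD
    have hA := h.isPathList hA hσa
    have hD := h.isPathList hD hzw'
    obtain ⟨B, rfl, pB⟩ := h.uncons hB hzw hzb.ne
    refine h.not_spanning (.of_path (((((IsPathList.single w).append pB hz).append
      (.single z) hzb.symm).append hA.reverse (h.adj_inv_apply hzw).symm).append hD hza'.symm)
      ha.symm fun v => ?_)
    have := hc v
    simp only [List.count_append, List.count_reverse] at this ⊢; omega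
  · rw [e] at hD
    have hA := h.isPathList hA hσa
    have hD := h.isPathList hD hzw
    obtain ⟨B, rfl, pB⟩ := h.uncons hB hzw' hzb'.ne
    refine h.not_spanning (.of_path (((((IsPathList.single w).append pB hz').append
      (.single z') hzb'.symm).append hA.reverse (h.adj_inv_apply hzw').symm).append hD hza.symm)
      ha.symm fun v => ?_)
    have := hc v
    simp only [List.count_append, List.count_reverse] at this ⊢; omega

end MissesOne

end Exchange

/-! ### Counting vertices around a cycle that misses one vertex -/

section Counting

variable {V : Type*} [DecidableEq V] [Fintype V] {G : SimpleGraph V} [DecidableRel G.Adj]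

open Classical in
/-- The vertices that can be exchanged with `w`, together with `w`. -/
noncomputable def exchSet (G : SimpleGraph V) (w : V) (σ : Equiv.Perm V) : Finset V :=
  {y | Exchangeable G w σ y}

open Classical in
/-- The neighbours of the vertices in `exchSet G w σ`. -/
noncomputable def exchNbrs (G : SimpleGraph V) (w : V) (σ : Equiv.Perm V) : Finset V :=
  {x | ∃ y, Exchangeable G w σ y ∧ G.Adj y x}

/-- The vertex `w` together with the images under `σ` of the vertices in `X`. -/
def shiftSet (w : V) (σ : Equiv.Perm V) (X : Finset V) : Finset V := insert w (X.image σ)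

theorem mem_exchSet {w y : V} {σ : Equiv.Perm V} :
    y ∈ exchSet G w σ ↔ Exchangeable G w σ y := by simp [exchSet]

theorem mem_exchNbrs {w x : V} {σ : Equiv.Perm V} :
    x ∈ exchNbrs G w σ ↔ ∃ y, Exchangeable G w σ y ∧ G.Adj y x := by simp [exchNbrs]

theorem mem_shiftSet {w u : V} {σ : Equiv.Perm V} {X : Finset V} :
    u ∈ shiftSet w σ X ↔ u = w ∨ ∃ x ∈ X, σ x = u := by simp [shiftSet]

theorem exchSet_inv (w : V) (σ : Equiv.Perm V) : exchSet G w σ⁻¹ = exchSet G w σ := by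
  ext y
  rw [mem_exchSet, mem_exchSet]
  exact ⟨fun h => by simpa using h.inv, fun h => h.inv⟩

theorem exchNbrs_inv (w : V) (σ : Equiv.Perm V) : exchNbrs G w σ⁻¹ = exchNbrs G w σ := by
  ext y
  simp only [mem_exchNbrs, ← mem_exchSet, exchSet_inv]

namespace MissesOne

variable {w : V} {σ : Equiv.Perm V}

theorem self_mem_exchSet : w ∈ exchSet G w σ := mem_exchSet.2 (.inl rfl)

theorem neighborFinset_subset : G.neighborFinset w ⊆ exchNbrs G w σ := fun x hx =>
  mem_exchNbrs.2 ⟨w, .inl rfl, by simpa using hx⟩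

theorem notMem_exchNbrs (h : MissesOne G w σ) {y : V} (hy : y ∈ exchSet G w σ) :
    y ∉ exchNbrs G w σ := by
  intro hy'
  obtain ⟨z, hz, hzy⟩ := mem_exchNbrs.1 hy'
  exact h.not_adj_exchangeable hz (mem_exchSet.1 hy) hzy

theorem apply_notMem_exchNbrs (h : MissesOne G w σ) {x : V} (hx : x ∈ exchNbrs G w σ) :
    σ x ∉ exchNbrs G w σ := by
  intro hx'
  obtain ⟨y, hy, hyx⟩ := mem_exchNbrs.1 hx
  obtain ⟨y', hy', hyx'⟩ := mem_exchNbrs.1 hx'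
  exact h.not_adj_apply_of_exchangeable hy hy' hyx hyx'

theorem card_shiftSet (h : MissesOne G w σ) {X : Finset V} (hX : w ∉ X) :
    #(shiftSet w σ X) = #X + 1 := by
  rw [shiftSet, card_insert_of_notMem, card_image_of_injective _ σ.injective]
  intro hw
  obtain ⟨x, hx, hxw⟩ := mem_image.1 hw
  refine h.apply_ne.2 ?_ hxw
  rintro rfl; exact hX hx

theorem two_mul_card_exchNbrs_lt (h : MissesOne G w σ) :
    2 * #(exchNbrs G w σ) < Fintype.card V := by
  have hd : Disjoint (exchNbrs G w σ) (shiftSet w σ (exchNbrs G w σ)) := by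
    rw [Finset.disjoint_right]
    intro u hu
    rcases mem_shiftSet.1 hu with rfl | ⟨x, hx, rfl⟩
    · exact h.notMem_exchNbrs self_mem_exchSet
    · exact h.apply_notMem_exchNbrs hx
  have h1 := card_union_of_disjoint hd
  have h2 := card_le_univ (exchNbrs G w σ ∪ shiftSet w σ (exchNbrs G w σ))
  rw [h.card_shiftSet (h.notMem_exchNbrs self_mem_exchSet)] at h1
  omega

theorem disjoint_shiftSet (h : MissesOne G w σ) {X : Finset V} (hX : X ⊆ exchNbrs G w σ) :
    Disjoint (shiftSet w σ X) (exchNbrs G w σ) := by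
  rw [Finset.disjoint_left]
  intro u hu
  rcases mem_shiftSet.1 hu with rfl | ⟨x, hx, rfl⟩
  · exact h.notMem_exchNbrs self_mem_exchSet
  · exact h.apply_notMem_exchNbrs (hX hx)

theorem exchSet_subset_shiftSet : exchSet G w σ ⊆ shiftSet w σ (G.neighborFinset w) := by
  intro y hy
  rcases mem_exchSet.1 hy with rfl | hy
  · exact mem_shiftSet.2 (.inl rfl)
  · exact mem_shiftSet.2 (.inr ⟨σ⁻¹ y, by simpa using hy.2, by simp⟩)

theorem exchSet_subset_shiftSet_inv : exchSet G w σ ⊆ shiftSet w σ⁻¹ (G.neighborFinset w) := by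
  rw [← exchSet_inv]; exact exchSet_subset_shiftSet

theorem shiftSet_inter_shiftSet_inv :
    shiftSet w σ (G.neighborFinset w) ∩ shiftSet w σ⁻¹ (G.neighborFinset w) = exchSet G w σ := by
  refine Finset.Subset.antisymm ?_
    (Finset.subset_inter exchSet_subset_shiftSet exchSet_subset_shiftSet_inv)
  intro y hy
  rw [mem_inter, mem_shiftSet, mem_shiftSet] at hy
  rw [mem_exchSet]
  rcases hy with ⟨rfl | ⟨x, hx, rfl⟩, hy⟩
  · exact .inl rfl
  · rcases hy with hy | ⟨x', hx', hxx'⟩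
    · exact .inl hy
    · refine .inr ⟨?_, by simpa using hx⟩
      rw [← hxx']; simpa using hx'

theorem not_adj_of_mem_shiftSet (h : MissesOne G w σ) {u v : V}
    (hu : u ∈ shiftSet w σ (G.neighborFinset w)) (hv : v ∈ shiftSet w σ (G.neighborFinset w)) :
    ¬ G.Adj u v := by
  rcases mem_shiftSet.1 hu with rfl | ⟨x, hx, rfl⟩
  · rcases mem_shiftSet.1 hv with rfl | ⟨y, hy, rfl⟩
    · simp
    · exact h.not_adj_apply (by simpa using hy)
  · rcases mem_shiftSet.1 hv with rfl | ⟨y, hy, rfl⟩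
    · exact fun hh => h.not_adj_apply (by simpa using hx) hh.symm
    · exact h.not_adj_apply_apply (by simpa using hx) (by simpa using hy)

/-- The neighbours of exchangeable vertices, the successors and the predecessors of neighbours of
`w` take up at most the whole vertex set. -/
theorem card_add_card_add_card_le (h : MissesOne G w σ) {B : Finset V}
    (hB : Disjoint B (exchNbrs G w σ)) (hB1 : Disjoint B (shiftSet w σ (G.neighborFinset w)))
    (hB2 : Disjoint B (shiftSet w σ⁻¹ (G.neighborFinset w))) :
    #B + #(exchNbrs G w σ) + 2 * (G.degree w + 1) ≤ Fintype.card V + #(exchSet G w σ) := by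
  have h1 := card_union_add_card_inter (shiftSet w σ (G.neighborFinset w))
    (shiftSet w σ⁻¹ (G.neighborFinset w))
  rw [shiftSet_inter_shiftSet_inv, h.card_shiftSet (by simp), h.inv.card_shiftSet (by simp),
    SimpleGraph.card_neighborFinset_eq_degree] at h1
  have d1 := h.disjoint_shiftSet (neighborFinset_subset (G := G) (w := w) (σ := σ))
  have d2 := h.inv.disjoint_shiftSet (neighborFinset_subset (G := G) (w := w) (σ := σ⁻¹))
  rw [exchNbrs_inv] at d2
  have h2 := card_union_of_disjoint (Finset.disjoint_union_left.2 ⟨d1, d2⟩)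
  have h3 := card_union_of_disjoint (Finset.disjoint_union_right.2
    ⟨Finset.disjoint_union_right.2 ⟨hB1, hB2⟩, hB⟩)
  have h4 := card_le_univ (B ∪ (shiftSet w σ (G.neighborFinset w) ∪
    shiftSet w σ⁻¹ (G.neighborFinset w) ∪ exchNbrs G w σ))
  omega

end MissesOne

/-! ### Colour classes around a cycle that misses one vertex -/

variable {k m H h e : ℕ} {c : V → Fin k}

/-- `c` is a proper colouring of `G` with `k` classes of size `m`, the number of vertices is
`H + h`, and all degrees are at least `H - e`. -/
structure IsBalancedDense (G : SimpleGraph V) [DecidableRel G.Adj] (c : V → Fin k)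
    (m H h e : ℕ) : Prop where
  proper : ∀ u v, G.Adj u v → c u ≠ c v
  card_class : ∀ i, #{v | c v = i} = m
  card_eq : Fintype.card V = H + h
  le_degree : ∀ v, H ≤ G.degree v + e

namespace IsBalancedDense

theorem card_eq_mul (hG : IsBalancedDense G c m H h e) : H + h = k * m := by
  rw [← hG.card_eq, card_eq_mul_of_classes hG.card_class]

/-- A set of non-neighbours of `v` contains many vertices of the colour of `v`. -/
theorem card_le_of_not_adj (hG : IsBalancedDense G c m H h e) {v : V} {P : Finset V}
    (hP : ∀ x ∈ P, ¬ G.Adj v x) : #P + m ≤ h + e + #{x ∈ P | c x = c v} := by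
  have hsub : G.neighborFinset v ⊆ (P ∪ ({x | c x = c v} : Finset V))ᶜ := by
    intro x hx
    rw [SimpleGraph.mem_neighborFinset] at hx
    simp only [mem_compl, mem_union, mem_filter, mem_univ, true_and, not_or]
    exact ⟨fun hxP => hP x hxP hx, fun hc => hG.proper v x hx hc.symm⟩
  have h1 := card_le_card hsub
  rw [SimpleGraph.card_neighborFinset_eq_degree, card_compl] at h1
  have h2 := card_union_add_card_inter P ({x | c x = c v} : Finset V)
  have e1 : P ∩ ({x | c x = c v} : Finset V) = {x ∈ P | c x = c v} := by ext; simp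
  rw [hG.card_class, e1] at h2
  have h3 := card_le_univ (P ∪ ({x | c x = c v} : Finset V))
  have h4 := hG.le_degree v
  have h5 := hG.card_eq
  omega

/-- In case of equality, `v` is adjacent to everything else. -/
theorem adj_of_card_le (hG : IsBalancedDense G c m H h e) {v : V} {P : Finset V}
    (hP : ∀ x ∈ P, ¬ G.Adj v x) (hcard : h + e + #{x ∈ P | c x = c v} ≤ #P + m) {u : V}
    (hu : u ∉ P) (huc : c u ≠ c v) : G.Adj v u := by
  by_contra hvu
  have h1 := hG.card_le_of_not_adj (P := insert u P) (v := v) (by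
    intro x hx
    rcases mem_insert.1 hx with rfl | hx
    · exact hvu
    · exact hP x hx)
  rw [card_insert_of_notMem hu, Finset.filter_insert, if_neg huc] at h1
  omega

end IsBalancedDense

/-- The union of the colour classes that contain exchangeable vertices. -/
noncomputable def exchClasses (G : SimpleGraph V) (c : V → Fin k) (w : V) (σ : Equiv.Perm V) :
    Finset V := {v | c v ∈ (exchSet G w σ).image c}

theorem exchClasses_inv (w : V) (σ : Equiv.Perm V) :
    exchClasses G c w σ⁻¹ = exchClasses G c w σ := by
  simp only [exchClasses, exchSet_inv]

theorem mem_exchClasses {w v : V} {σ : Equiv.Perm V} :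
    v ∈ exchClasses G c w σ ↔ ∃ y ∈ exchSet G w σ, c y = c v := by simp [exchClasses]

theorem exchSet_subset_exchClasses {w : V} {σ : Equiv.Perm V} :
    exchSet G w σ ⊆ exchClasses G c w σ := fun y hy => mem_exchClasses.2 ⟨y, hy, rfl⟩

namespace MissesOne

variable {w : V} {σ : Equiv.Perm V}

theorem card_exchClasses (hG : IsBalancedDense G c m H h e) :
    #(exchClasses G c w σ) = #((exchSet G w σ).image c) * m := by
  rw [card_eq_sum_card_fiberwise (f := c) (t := (exchSet G w σ).image c)
    (fun v hv => by simpa [exchClasses] using hv)]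
  rw [Finset.sum_const_nat (m := m)]
  intro i hi
  rw [← hG.card_class i]
  congr 1
  ext v
  simp only [exchClasses, mem_filter, mem_univ, true_and, and_iff_right_iff_imp]
  rintro rfl; exact hi

theorem mul_le_card_exchClasses_sdiff (hG : IsBalancedDense G c m H h e) :
    #((exchSet G w σ).image c) * (H + m - #(exchNbrs G w σ) - e) ≤
      #(exchClasses G c w σ \ exchNbrs G w σ) := by
  rw [mul_comm, card_eq_sum_card_fiberwise (f := c) (t := (exchSet G w σ).image c)
    (s := exchClasses G c w σ \ exchNbrs G w σ)
    (fun v hv => by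
      have := (mem_sdiff.1 hv).1
      simpa [exchClasses] using this), mul_comm, ← smul_eq_mul]
  refine Finset.card_nsmul_le_sum _ _ _ ?_
  intro i hi
  obtain ⟨y, hy, rfl⟩ := mem_image.1 hi
  have h1 := hG.card_le_of_not_adj (v := y) (P := (exchNbrs G w σ)ᶜ) (by
    intro x hx hyx
    exact mem_compl.1 hx (mem_exchNbrs.2 ⟨y, mem_exchSet.1 hy, hyx⟩))
  have h2 : ({x ∈ (exchNbrs G w σ)ᶜ | c x = c y} : Finset V) ⊆
      {x ∈ exchClasses G c w σ \ exchNbrs G w σ | c x = c y} := by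
    intro x hx
    simp only [mem_filter, mem_compl, mem_sdiff] at hx ⊢
    exact ⟨⟨mem_exchClasses.2 ⟨y, hy, hx.2.symm⟩, hx.1⟩, hx.2⟩
  have h3 := card_le_card h2
  rw [card_compl] at h1
  have h4 := hG.card_eq
  have h5 := card_le_univ (exchNbrs G w σ)
  omega

/-- Exchangeable vertices occur in at most half of the classes. This is where the exact value of
the degree condition is needed. -/
theorem card_image_exchSet_le (hM : MissesOne G w σ) (hG : IsBalancedDense G c m H h e)
    (hhH : h ≤ H) (hem : e ≤ m) (hr : h + 2 ≤ (k / 2 + 1) * (m - e + 1)) :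
    #((exchSet G w σ).image c) ≤ k / 2 := by
  by_contra! hcon
  have h1 := mul_le_card_exchClasses_sdiff (w := w) (σ := σ) hG
  have h2 : #(exchClasses G c w σ \ exchNbrs G w σ) ≤ #(exchNbrs G w σ)ᶜ :=
    card_le_card fun x hx => mem_compl.2 (mem_sdiff.1 hx).2
  rw [card_compl, hG.card_eq] at h2
  have h3 := hM.two_mul_card_exchNbrs_lt
  rw [hG.card_eq] at h3
  obtain ⟨j, hj⟩ := Nat.exists_eq_add_of_le (show #(exchNbrs G w σ) + 1 ≤ H by omega)
  have e1 : H + m - #(exchNbrs G w σ) - e = (m - e + 1) + j := by omega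
  rw [e1] at h1
  have h4 : (k / 2 + 1) * ((m - e + 1) + j) ≤ _ := Nat.mul_le_mul_right _ hcon
  have h5 : (k / 2 + 1) * (m - e + 1) + j ≤ (k / 2 + 1) * ((m - e + 1) + j) := by
    rw [Nat.mul_add (k / 2 + 1) (m - e + 1) j]
    have := Nat.mul_le_mul_right j (show 1 ≤ k / 2 + 1 by omega)
    omega
  have h6 := (h5.trans h4).trans (h1.trans h2)
  generalize (k / 2 + 1) * (m - e + 1) = Q at hr h6
  omega

/-- If some successor of a neighbour of `w` has a colour that does not occur on exchangeable
vertices, then many of these successors have this colour. -/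
theorem exists_class_of_not_subset (hM : MissesOne G w σ) (hG : IsBalancedDense G c m H h e)
    (hT : ¬ shiftSet w σ (G.neighborFinset w) ⊆ exchClasses G c w σ) :
    ∃ Z : Finset V, (∃ i, Z = {x ∈ shiftSet w σ (G.neighborFinset w) | c x = i} ∧
        ∀ v, c v = i → v ∉ exchClasses G c w σ) ∧
      G.degree w + 1 + m ≤ h + e + #Z ∧ #Z + #(exchSet G w σ) ≤ G.degree w + 1 := by
  obtain ⟨z, hz, hzA⟩ := Finset.not_subset.1 hT
  have hi : ∀ v, c v = c z → v ∉ exchClasses G c w σ := by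
    intro v hv hvA
    obtain ⟨y, hy, hyv⟩ := mem_exchClasses.1 hvA
    exact hzA (mem_exchClasses.2 ⟨y, hy, hyv.trans hv⟩)
  refine ⟨_, ⟨c z, rfl, hi⟩, ?_, ?_⟩
  · have := hG.card_le_of_not_adj (v := z) (P := shiftSet w σ (G.neighborFinset w))
      (fun x hx => hM.not_adj_of_mem_shiftSet hz hx)
    rwa [hM.card_shiftSet (by simp), SimpleGraph.card_neighborFinset_eq_degree] at this
  · rw [← SimpleGraph.card_neighborFinset_eq_degree, ← hM.card_shiftSet (by simp),
      ← card_union_of_disjoint]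
    · exact card_le_card (union_subset (filter_subset _ _) exchSet_subset_shiftSet)
    · rw [Finset.disjoint_left]
      intro x hx hx'
      exact hi x (mem_filter.1 hx).2 (exchSet_subset_exchClasses hx')

end MissesOne

end Counting

/-! ### Odd and even numbers of colour classes -/

section Contradictions

variable {V : Type*} [DecidableEq V] [Fintype V] {G : SimpleGraph V} [DecidableRel G.Adj]
variable {k m H h e : ℕ} {c : V → Fin k} {w : V} {σ : Equiv.Perm V}

namespace MissesOne

theorem card_add_card_le (hM : MissesOne G w σ) (hG : IsBalancedDense G c m H h e) :
    #(exchNbrs G w σ) + 2 * (G.degree w + 1) ≤ H + h + #(exchSet G w σ) := by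
  have := hM.card_add_card_add_card_le (B := ∅) (by simp) (by simp) (by simp)
  rw [hG.card_eq] at this
  simpa using this

theorem degree_le_card_exchNbrs : G.degree w ≤ #(exchNbrs G w σ) := by
  rw [← SimpleGraph.card_neighborFinset_eq_degree]
  exact card_le_card neighborFinset_subset

/-- For odd `k`, the successors of the neighbours of `w` are too many for the classes of the
exchangeable vertices, but those that are not exchangeable are too few to fill a large part of
another class. -/
theorem false_of_odd (hM : MissesOne G w σ) (hG : IsBalancedDense G c m H h e)
    (hk : Odd k) (hhH : h ≤ H) (hm : 4 * e ≤ m + 1) (hem : e ≤ m)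
    (hr : h + 2 ≤ (k / 2 + 1) * (m - e + 1)) : False := by
  have ht := hM.card_image_exchSet_le hG hhH hem hr
  have h1 := hM.card_add_card_le hG
  have h2 := degree_le_card_exchNbrs (G := G) (w := w) (σ := σ)
  have h3 := hG.le_degree w
  by_cases hT : shiftSet w σ (G.neighborFinset w) ⊆ exchClasses G c w σ
  · have h4 := card_le_card hT
    rw [hM.card_shiftSet (by simp), SimpleGraph.card_neighborFinset_eq_degree,
      card_exchClasses hG] at h4
    have h5 := Nat.mul_le_mul_right m ht
    have h6 : 2 * (k / 2 * m) + m = H + h := by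
      rw [hG.card_eq_mul]
      conv_rhs => rw [← Nat.two_mul_div_two_add_one_of_odd hk]
      ring
    omega
  · obtain ⟨Z, -, h4, h5⟩ := hM.exists_class_of_not_subset hG hT
    omega

/-- The case of four colour classes in which all successors, but not all predecessors, of
neighbours of `w` lie in the two classes of the exchangeable vertices. All inequalities are tight,
and the adjacencies forced by this allow an exchange along two chords. -/
theorem false_of_subset_of_not_subset (hM : MissesOne G w σ) (hG : IsBalancedDense G c m H H e)
    (hm : 3 * e ≤ m + 1) (hm3 : 3 ≤ m)
    (hβ : #((exchClasses G c w σ)ᶜ \ exchNbrs G w σ) + H ≤ 2 * e + #(exchNbrs G w σ))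
    (hT : shiftSet w σ (G.neighborFinset w) ⊆ exchClasses G c w σ)
    (hT' : ¬ shiftSet w σ⁻¹ (G.neighborFinset w) ⊆ exchClasses G c w σ) : False := by
  rw [← exchClasses_inv] at hT'
  obtain ⟨Z, ⟨i, hZ, hi⟩, hZ1, hZ2⟩ := hM.inv.exists_class_of_not_subset hG hT'
  rw [exchClasses_inv] at hi
  rw [exchSet_inv] at hZ2
  have memZ : ∀ {z}, z ∈ Z ↔ (z = w ∨ ∃ x, G.Adj w x ∧ σ⁻¹ x = z) ∧ c z = i := by
    intro z; rw [hZ, mem_filter, mem_shiftSet]; simp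
  set X := exchNbrs G w σ with hX
  set T := shiftSet w σ⁻¹ X with hTdef
  have hwX : w ∉ X := hM.notMem_exchNbrs self_mem_exchSet
  have hcT : #T = #X + 1 := hM.inv.card_shiftSet hwX
  have hwA : c w ≠ i := fun hh => hi w hh (exchSet_subset_exchClasses self_mem_exchSet)
  have hXinv : ∀ x ∈ X, σ⁻¹ x ∉ X := by
    intro x hx
    have := hM.inv.apply_notMem_exchNbrs (x := x) (by rw [exchNbrs_inv]; exact hx)
    rwa [exchNbrs_inv] at this
  have hZadj : ∀ z ∈ Z, G.Adj w (σ z) := by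
    intro z hz
    rcases memZ.1 hz with ⟨rfl | ⟨x, hx, rfl⟩, hzi⟩
    · exact absurd hzi hwA
    · simpa using hx
  have hZX : ∀ z ∈ Z, z ∉ X := by
    intro z hz hzX
    exact hM.apply_notMem_exchNbrs hzX (neighborFinset_subset (by simpa using hZadj z hz))
  -- the vertices of `Z` have no neighbours in `T`
  have hZT : ∀ z ∈ Z, ∀ x ∈ T, ¬ G.Adj z x := by
    intro z hz x hx
    have hz' : z = σ⁻¹ (σ z) := by simp
    rw [hz']
    rcases mem_shiftSet.1 hx with rfl | ⟨x, hxX, rfl⟩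
    · exact fun hh => hM.inv.not_adj_apply (hZadj z hz) hh.symm
    · obtain ⟨y, hy, hyx⟩ := mem_exchNbrs.1 hxX
      exact hM.inv.not_adj_apply_apply_of_exchangeable (hZadj z hz) hy.inv hyx
  have hTX : ∀ x ∈ T, x ∉ X := by
    intro x hx
    rcases mem_shiftSet.1 hx with rfl | ⟨x, hxX, rfl⟩
    · exact hwX
    · exact hXinv x hxX
  have hTi : ({x ∈ T | c x = i} : Finset V) ⊆ (exchClasses G c w σ)ᶜ \ X := by
    intro x hx
    obtain ⟨hx, hxi⟩ := mem_filter.1 hx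
    exact mem_sdiff.2 ⟨mem_compl.2 (hi x hxi), hTX x hx⟩
  have hTi' := card_le_card hTi
  have hdeg := hG.le_degree w
  have hX0 : G.degree w ≤ #X := degree_le_card_exchNbrs
  have hX2 : 2 * #X < H + H := by rw [← hG.card_eq]; exact hM.two_mul_card_exchNbrs_lt
  have hY := hM.card_add_card_le hG
  have hZne : Z.Nonempty := Finset.card_pos.1 (by omega)
  obtain ⟨z₀, hz₀⟩ := hZne
  have hci : ∀ z ∈ Z, c z = i := fun z hz => (memZ.1 hz).2
  have hT0 := hG.card_le_of_not_adj (hZT z₀ hz₀)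
  rw [hcT, hci z₀ hz₀] at hT0
  have heqm : m + 1 = 3 * e := by omega
  have hTeq : ({x ∈ T | c x = i} : Finset V) = (exchClasses G c w σ)ᶜ \ X :=
    Finset.eq_of_subset_of_card_le hTi (by omega)
  have hZall : ∀ z ∈ Z, ∀ u, u ∉ T → c u ≠ i → G.Adj z u := by
    intro z hz u hu hui
    refine hG.adj_of_card_le (hZT z hz) ?_ hu (by rwa [hci z hz])
    rw [hcT, hci z hz]; omega
  have hX1 : #X + 2 ≤ H := by
    have h1 : shiftSet w σ (G.neighborFinset w) ⊆ exchClasses G c w σ \ X := by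
      intro x hx
      exact mem_sdiff.2 ⟨hT hx,
        Finset.disjoint_left.1 (hM.disjoint_shiftSet neighborFinset_subset) hx⟩
    have h2 := card_le_card h1
    rw [hM.card_shiftSet (by simp), SimpleGraph.card_neighborFinset_eq_degree] at h2
    have h3 : Disjoint (exchClasses G c w σ \ X) ((exchClasses G c w σ)ᶜ \ X) :=
      disjoint_compl_right.mono sdiff_subset sdiff_subset
    have h4 := card_union_of_disjoint h3
    have h5 : (exchClasses G c w σ \ X) ∪ ((exchClasses G c w σ)ᶜ \ X) ⊆ Xᶜ := by
      intro x hx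
      rcases mem_union.1 hx with hx | hx <;> exact mem_compl.2 (mem_sdiff.1 hx).2
    have h6 := card_le_card h5
    rw [card_compl, hG.card_eq] at h6
    omega
  -- an exchange is possible at all vertices but those next to `X \ N(w)`
  have hXN : #(X \ G.neighborFinset w) + G.degree w = #X := by
    rw [card_sdiff_of_subset neighborFinset_subset, SimpleGraph.card_neighborFinset_eq_degree,
      ← hX, Nat.sub_add_cancel hX0]
  have hZbad : #{z ∈ Z | σ⁻¹ z ∈ X} ≤ #(X \ G.neighborFinset w) := by
    refine Finset.card_le_card_of_injOn (fun z => σ⁻¹ z) ?_ σ⁻¹.injective.injOn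
    intro z hz
    obtain ⟨hz, hzX⟩ := mem_filter.1 hz
    refine mem_sdiff.2 ⟨hzX, fun hzN => ?_⟩
    refine hi z (hci z hz) (exchSet_subset_exchClasses (mem_exchSet.2 (.inr ⟨hZadj z hz, ?_⟩)))
    simpa using hzN
  have hZgood : 1 < #{z ∈ Z | σ⁻¹ z ∉ X} := by
    have := Finset.card_filter_add_card_filter_not (s := Z) (fun z => σ⁻¹ z ∈ X)
    omega
  obtain ⟨z, hz, z', hz', hzz'⟩ := Finset.one_lt_card.1 hZgood
  rw [mem_filter] at hz hz'
  have hexa : ∃ a, G.Adj w a ∧ σ (σ a) ∉ X := by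
    by_contra! hcon
    have h1 : #(shiftSet w σ (G.neighborFinset w) \ exchSet G w σ) ≤
        #(X \ G.neighborFinset w) := by
      refine Finset.card_le_card_of_injOn σ ?_ σ.injective.injOn
      intro u hu
      obtain ⟨hu, huY⟩ := mem_sdiff.1 hu
      rcases mem_shiftSet.1 hu with rfl | ⟨a, ha, rfl⟩
      · exact absurd self_mem_exchSet huY
      · rw [SimpleGraph.mem_neighborFinset] at ha
        refine mem_sdiff.2 ⟨hcon a ha, fun hzN => ?_⟩
        refine huY (mem_exchSet.2 (.inr ⟨?_, ?_⟩))
        · simpa using hzN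
        · simpa using ha
    rw [card_sdiff_of_subset exchSet_subset_shiftSet, hM.card_shiftSet (by simp),
      SimpleGraph.card_neighborFinset_eq_degree] at h1
    omega
  obtain ⟨a, ha, haX⟩ := hexa
  have haT : σ a ∉ T := by
    intro haT
    rcases mem_shiftSet.1 haT with haw | ⟨x, hx, hxa⟩
    · exact hM.apply_ne.2 ha.ne' haw
    · refine haX ?_
      rw [← hxa]; simpa using hx
  have hai : c (σ a) ≠ i := fun hh =>
    hi _ hh (hT (mem_shiftSet.2 (.inr ⟨a, by simpa using ha, rfl⟩)))
  have hpred : ∀ z ∈ Z, σ⁻¹ z ∉ X → σ⁻¹ z ∉ T ∧ c (σ⁻¹ z) ≠ i := by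
    intro z hz hzX
    have h1 : σ⁻¹ z ∉ T := by
      intro hzT
      rcases mem_shiftSet.1 hzT with hzw | ⟨x, hx, hxz⟩
      · refine hM.inv_apply_ne.2 ?_ hzw
        exact fun hh => hwA (hh ▸ hci z hz)
      · exact hZX z hz (by rwa [← σ⁻¹.injective hxz])
    refine ⟨h1, fun hh => h1 ?_⟩
    have : σ⁻¹ z ∈ (exchClasses G c w σ)ᶜ \ X := mem_sdiff.2 ⟨mem_compl.2 (hi _ hh), hzX⟩
    rw [← hTeq] at this
    exact (mem_filter.1 this).1
  obtain ⟨p1, p2⟩ := hpred z hz.1 hz.2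
  obtain ⟨p1', p2'⟩ := hpred z' hz'.1 hz'.2
  exact hM.not_adj_of_two_chords ha (hZadj z hz.1) (hZadj z' hz'.1) hzz'
    (hZall z hz.1 _ haT hai) (hZall z' hz'.1 _ haT hai) (hZall z hz.1 _ p1' p2')
    (hZall z' hz'.1 _ p1 p2)

/-- For `k = 2 * p`, the exchangeable vertices occur in exactly half of the classes. Which estimate
gives the contradiction depends on whether the successors and the predecessors of the neighbours
of `w` all lie in these classes. -/
theorem false_of_even (hM : MissesOne G w σ) (hG : IsBalancedDense G c m H H e)
    {p : ℕ} (hp : 2 ≤ p) (hk : k = 2 * p) (hm : 3 * e ≤ m + 1) (hm' : 3 ≤ p → 4 * e ≤ m + 2)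
    (hm3 : 3 ≤ m) (hem : e ≤ m) (hr : H + 2 ≤ (k / 2 + 1) * (m - e + 1)) : False := by
  have hk2 : k / 2 = p := by omega
  have ht := hM.card_image_exchSet_le hG le_rfl hem hr
  rw [hk2] at ht
  have hHp : H = p * m := by
    have h1 := hG.card_eq_mul
    rw [hk, Nat.mul_assoc] at h1
    omega
  have hdeg := hG.le_degree w
  have hX0 := degree_le_card_exchNbrs (G := G) (w := w) (σ := σ)
  have hX2 : 2 * #(exchNbrs G w σ) < H + H := by
    rw [← hG.card_eq]; exact hM.two_mul_card_exchNbrs_lt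
  have hY := hM.card_add_card_le hG
  have hYA := card_le_card (exchSet_subset_exchClasses (G := G) (c := c) (w := w) (σ := σ))
  -- exchangeable vertices occur in exactly half of the classes
  have htp : #((exchSet G w σ).image c) = p := by
    by_contra hne
    have h1 := Nat.mul_le_mul_right m (show #((exchSet G w σ).image c) + 1 ≤ p by omega)
    rw [Nat.add_mul, ← card_exchClasses hG, ← hHp] at h1
    omega
  have hA : #(exchClasses G c w σ) = H := by rw [card_exchClasses hG, htp, hHp]
  have hA1 := mul_le_card_exchClasses_sdiff (w := w) (σ := σ) hG
  rw [htp] at hA1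
  set X := exchNbrs G w σ with hX
  set A := exchClasses G c w σ with hAdef
  set B := Aᶜ \ X with hB
  have hsum : #(A \ X) + #B + #X = H + H := by
    have h3 : Disjoint (A \ X) B := disjoint_compl_right.mono sdiff_subset sdiff_subset
    have h5 : (A \ X) ∪ B = Xᶜ := by
      ext x; simp only [hB, mem_union, mem_sdiff, mem_compl]; tauto
    have h4 := card_union_of_disjoint h3
    rw [h5, card_compl, hG.card_eq] at h4
    omega
  have hAX := card_le_card (sdiff_subset : A \ X ⊆ A)
  -- `B` has at most `j + p * (e - j)` elements, where `j = H - #X`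
  have hBle : #B + #X ≤ H + p * (#X + e - H) := by
    have h1 : p * (H + m - #X - e) + p * (#X + e - H) = p * m := by
      rw [← Nat.mul_add]; congr 1; omega
    omega
  have hBX : Disjoint B X := by
    rw [Finset.disjoint_left]; intro x hx; exact (mem_sdiff.1 hx).2
  have hinv : exchSet G w σ⁻¹ = exchSet G w σ := exchSet_inv w σ
  have hZB : ∀ τ : Equiv.Perm V, exchNbrs G w τ = X → MissesOne G w τ → ∀ i,
      (∀ v, c v = i → v ∉ A) →
      ({x ∈ shiftSet w τ (G.neighborFinset w) | c x = i} : Finset V) ⊆ B := by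
    intro τ hτ hMτ i hi x hx
    obtain ⟨hx, hxi⟩ := mem_filter.1 hx
    refine mem_sdiff.2 ⟨mem_compl.2 (hi x hxi), ?_⟩
    rw [← hτ]
    exact Finset.disjoint_left.1 (hMτ.disjoint_shiftSet neighborFinset_subset) hx
  have hXinv : exchNbrs G w σ⁻¹ = X := exchNbrs_inv w σ
  have hAinv : exchClasses G c w σ⁻¹ = A := exchClasses_inv w σ
  -- with at least six classes, both `T⁺` and `T⁻` lie in `A`; with four, this fails in a tight
  -- situation only
  have hp2 : ∀ z : ℕ, G.degree w + 1 + m ≤ H + e + z → z + #(exchSet G w σ) ≤ G.degree w + 1 →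
      z ≤ #B → p = 2 := by
    intro z h1 h2 h3
    by_contra hne
    have h4 := hm' (by omega)
    have h5 : #X + e - H = 0 := by omega
    rw [h5, Nat.mul_zero] at hBle
    omega
  by_cases hT : shiftSet w σ (G.neighborFinset w) ⊆ A
  · by_cases hT' : shiftSet w σ⁻¹ (G.neighborFinset w) ⊆ A
    · have hBA : Disjoint B A := by
        rw [Finset.disjoint_left]; intro x hx; exact mem_compl.1 (mem_sdiff.1 hx).1
      have h1 := hM.card_add_card_add_card_le hBX (hBA.mono_right hT) (hBA.mono_right hT')
      rw [hG.card_eq, ← hX] at h1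
      have hBne : B.Nonempty := Finset.card_pos.1 (by omega)
      obtain ⟨z, hz⟩ := hBne
      have h2 := hG.card_le_of_not_adj (v := z) (P := exchSet G w σ) (by
        intro y hy hzy
        exact (mem_sdiff.1 hz).2 (mem_exchNbrs.2 ⟨y, mem_exchSet.1 hy, hzy.symm⟩))
      have h3 : ({y ∈ exchSet G w σ | c y = c z} : Finset V) = ∅ := by
        rw [Finset.filter_eq_empty_iff]
        intro y hy hyz
        exact mem_compl.1 (mem_sdiff.1 hz).1 (mem_exchClasses.2 ⟨y, hy, hyz⟩)
      rw [h3, card_empty] at h2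
      omega
    · obtain ⟨Z, ⟨i, hZ, hi⟩, h1, h2⟩ := hM.inv.exists_class_of_not_subset hG (by rwa [hAinv])
      rw [hinv] at h2
      rw [hAinv] at hi
      have h3 : Z ⊆ B := by rw [hZ]; exact hZB _ hXinv hM.inv i hi
      have hp2 := hp2 _ h1 h2 (card_le_card h3)
      rw [hp2] at hBle
      refine hM.false_of_subset_of_not_subset hG hm hm3 ?_ hT hT'
      change #B + H ≤ 2 * e + #X
      omega
  · obtain ⟨Z, ⟨i, hZ, hi⟩, h1, h2⟩ := hM.exists_class_of_not_subset hG hT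
    have h3 : Z ⊆ B := by rw [hZ]; exact hZB _ rfl hM i hi
    have hp2 := hp2 _ h1 h2 (card_le_card h3)
    rw [hp2] at hBle
    by_cases hT' : shiftSet w σ⁻¹ (G.neighborFinset w) ⊆ A
    · refine hM.inv.false_of_subset_of_not_subset hG hm hm3 ?_ (by rwa [hAinv])
        (by rwa [hAinv, inv_inv])
      rw [hAinv, hXinv]
      change #B + H ≤ 2 * e + #X
      omega
    · obtain ⟨Z', ⟨i', hZ', hi'⟩, h1', h2'⟩ :=
        hM.inv.exists_class_of_not_subset hG (by rwa [hAinv])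
      rw [hAinv] at hi'
      have h3' : Z' ⊆ B := by rw [hZ']; exact hZB _ hXinv hM.inv i' hi'
      have hd : Disjoint Z Z' := by
        rw [Finset.disjoint_left]
        intro x hx hx'
        rw [hZ, mem_filter] at hx
        rw [hZ', mem_filter] at hx'
        have : x ∈ exchSet G w σ := by
          rw [← shiftSet_inter_shiftSet_inv]
          exact mem_inter.2 ⟨hx.1, hx'.1⟩
        exact hi x hx.2 (exchSet_subset_exchClasses this)
      have h4 := card_union_of_disjoint hd
      have h5 := card_le_card (union_subset h3 h3')
      omega

end MissesOne

end Contradictions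

/-! ### Arithmetic of the degree condition -/

section Arithmetic

theorem ceil_natCast_div_two (a : ℕ) : ⌈(a : ℚ) / 2⌉ = (((a + 1) / 2 : ℕ) : ℤ) := by
  rw [Int.ceil_eq_iff]
  rcases Nat.even_or_odd' a with ⟨b, rfl | rfl⟩
  · rw [show (2 * b + 1) / 2 = b by omega]
    push_cast
    constructor <;> linarith
  · rw [show (2 * b + 1 + 1) / 2 = b + 1 by omega]
    push_cast
    constructor <;> linarith

theorem floor_natCast_div (a b : ℕ) : ⌊(a : ℚ) / (b : ℚ)⌋ = ((a / b : ℕ) : ℤ) := by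
  rw [← Nat.floor_div_eq_div (K := ℚ) a b, Int.natCast_floor_eq_floor (by positivity)]

theorem two_mul_ceil (k : ℕ) :
    (2 * (⌈((k : ℚ) + 1) / 2⌉ : ℚ)) = ((2 * (k / 2 + 1) : ℕ) : ℚ) := by
  have := ceil_natCast_div_two (k + 1)
  rw [Nat.cast_add_one] at this
  rw [this, show (k + 1 + 1) / 2 = k / 2 + 1 by omega, Int.cast_natCast]
  push_cast; ring

theorem degreeThreshold_eq {n k m : ℕ} (hk : 0 < k) (hn : n = k * m) :
    degreeThreshold n k =
      (((n + 1) / 2 + (n + 2) / (2 * (k / 2 + 1)) : ℕ) : ℚ) - (m : ℚ) := by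
  have h1 : (n : ℚ) / k = m := by
    rw [hn]; push_cast
    field_simp
  have h2 := floor_natCast_div (n + 2) (2 * (k / 2 + 1))
  rw [Nat.cast_add n 2, Nat.cast_ofNat] at h2
  rw [degreeThreshold, two_mul_ceil, ceil_natCast_div_two, h1, h2, Int.cast_natCast,
    Int.cast_natCast, Nat.cast_add]

/-- The condition of Chen, Faudree, Gould, Jacobson and Lesniak, cleared of denominators. -/
theorem add_div_le_of_lt {n k x : ℕ} (hk : 2 ≤ k)
    (hx : (k / 2 + 1) * n + n < 2 * (k / 2 + 1) * x) :
    (n + 1) / 2 + (n + 2) / (2 * (k / 2 + 1)) ≤ x := by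
  set r := k / 2 + 1 with hr
  have hr2 : 2 ≤ r := by omega
  obtain ⟨a, rfl⟩ : ∃ a, x = (n + 1) / 2 + a := by
    refine Nat.exists_eq_add_of_le ?_
    by_contra! hcon
    have : 2 * x ≤ n := by omega
    have := Nat.mul_le_mul_left r this
    nlinarith
  have : (n + 2) / (2 * r) < a + 1 := by
    rw [Nat.div_lt_iff_lt_mul (by omega)]
    rcases Nat.even_or_odd' n with ⟨b, hb | hb⟩
    · rw [show (n + 1) / 2 = b by omega] at hx
      have : b < r * a := by rw [hb] at hx; nlinarith
      nlinarith
    · rw [show (n + 1) / 2 = b + 1 by omega] at hx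
      have : n < r * (2 * a + 1) := by
        have : 2 * r * (b + 1 + a) = r * n + r * (2 * a + 1) := by rw [hb]; ring
        omega
      nlinarith
  omega

/-- The numerical consequences of the degree condition for odd `k`; here `m - e` is the quotient
`(n + 2) / (k + 1)`. -/
theorem bounds_of_odd {k m H h e : ℕ} (hk : Odd k) (hk3 : 3 ≤ k) (hn : H + h = k * m)
    (hhH : h ≤ H) (he : 1 ≤ e) (hem : e ≤ m)
    (hlt : k * m + 3 ≤ 2 * (k / 2 + 1) * (m - e + 1)) :
    3 ≤ m ∧ 4 * e ≤ m + 1 ∧ k * e + 2 ≤ H := by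
  obtain ⟨f, rfl⟩ := Nat.exists_eq_add_of_le hem
  obtain ⟨e, rfl⟩ := Nat.exists_eq_add_of_le' he
  rw [show 2 * (k / 2 + 1) = k + 1 by have := Nat.two_mul_div_two_add_one_of_odd hk; omega,
    Nat.add_sub_cancel_left] at hlt
  have h1 : (k + 1) * e + 3 ≤ e + 1 + f := by nlinarith
  have h2 : 4 * e ≤ (k + 1) * e := Nat.mul_le_mul_right _ (by omega)
  refine ⟨by omega, by omega, ?_⟩
  rcases eq_or_lt_of_le hk3 with rfl | hk4
  · omega
  · have h3 : 2 * (k * (e + 1) + 2) ≤ k * (e + 1 + f) := by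
      obtain ⟨t, ht⟩ := Nat.exists_eq_add_of_le h1
      obtain ⟨s, rfl⟩ := Nat.exists_eq_add_of_le hk4
      rw [ht]
      nlinarith [Nat.zero_le (s * t), Nat.zero_le (s * e), Nat.zero_le (s * s * e)]
    omega

/-- The numerical consequences of the degree condition for `k = 2 * p`. -/
theorem bounds_of_even {p m H e : ℕ} (hp : 2 ≤ p) (hn : H = p * m) (hm : 3 ≤ m)
    (he : 1 ≤ e) (hem : e ≤ m) (hlt : p * m + 2 ≤ (p + 1) * (m - e + 1)) :
    3 * e ≤ m + 1 ∧ (3 ≤ p → 4 * e ≤ m + 2) ∧ 2 * p * e + 2 ≤ H := by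
  obtain ⟨f, rfl⟩ := Nat.exists_eq_add_of_le hem
  obtain ⟨e, rfl⟩ := Nat.exists_eq_add_of_le' he
  rw [Nat.add_sub_cancel_left] at hlt
  have h1 : (p + 1) * e + 2 ≤ e + 1 + f := by nlinarith
  have h2 : 3 * e ≤ (p + 1) * e := Nat.mul_le_mul_right _ (by omega)
  refine ⟨by omega, fun hp3 => ?_, ?_⟩
  · have h3 : 4 * e ≤ (p + 1) * e := Nat.mul_le_mul_right _ (by omega)
    omega
  · rcases Nat.eq_zero_or_pos e with rfl | he'
    · rw [hn]; nlinarith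
    · obtain ⟨t, ht⟩ := Nat.exists_eq_add_of_le h1
      obtain ⟨s, rfl⟩ := Nat.exists_eq_add_of_le hp
      rw [hn, ht]
      nlinarith [Nat.zero_le (s * t), Nat.zero_le (s * e), Nat.zero_le (s * s * e)]

end Arithmetic

/-! ### Spanning cycles in balanced multipartite graphs -/

section Main

variable {V : Type*} [DecidableEq V] [Fintype V] {G : SimpleGraph V} [DecidableRel G.Adj]
variable {k m H h e : ℕ} {c : V → Fin k}

theorem IsBalancedDense.mono {G' : SimpleGraph V} [DecidableRel G'.Adj]
    (hG : IsBalancedDense G c m H h e) (hle : G ≤ G') (hle' : G' ≤ completePartite c) :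
    IsBalancedDense G' c m H h e :=
  ⟨fun _ _ huv => hle' huv, hG.card_class, hG.card_eq, fun v =>
    (hG.le_degree v).trans (Nat.add_le_add_right (SimpleGraph.degree_le_of_le hle) e)⟩

/-- A dense balanced `k`-partite graph without a spanning cycle can be enlarged to one that has a
cycle missing exactly one vertex, and still no spanning cycle. -/
theorem IsBalancedDense.exists_missesOne (hG : IsBalancedDense G c m H h e) (hk : 3 ≤ k)
    (hhH : h ≤ H) (he : 1 ≤ e) (h1 : k * e + 2 ≤ H)
    (h2 : H + h + 1 < 3 * (H - e)) (h3 : 5 * (H + h) < 12 * (H - e) + 7)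
    (hns : ¬ HasSpanningCycle G) :
    ∃ (G' : SimpleGraph V) (_ : DecidableRel G'.Adj) (w : V) (σ : Equiv.Perm V),
      IsBalancedDense G' c m H h e ∧ MissesOne G' w σ := by
  classical
  have hcard : 3 ≤ Fintype.card V := by rw [hG.card_eq]; omega
  obtain ⟨G', hGG', hG'K, hG', a, b, l, hl, -, hc⟩ :=
    exists_le_isPathList (K := completePartite c) (fun u v huv => hG.proper u v huv) hns
      (hasSpanningCycle_completePartite hG.card_class (by omega) hcard) hcard
  have hD := hG.mono hGG' hG'K
  obtain ⟨S, σ, R, hE, hlink⟩ := exists_isExtremal hl hc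
    (by rw [length_of_count_eq_one hc]; omega) hG'
  have hlen := hE.length_eq_one hlink (k := k) (d := H - e) (e := e) (c := c) (by omega)
    hD.proper (fun v => by have := hD.le_degree v; omega) (by rw [hD.card_eq]; omega)
    (by rw [hD.card_eq]; omega) (by
      rw [hD.card_eq]
      have := Nat.mul_le_mul_right e (show 1 ≤ k by omega)
      omega) (by
      have e1 : (k - 1) * e + e = k * e := by
        rw [← Nat.succ_mul, Nat.succ_eq_add_one, Nat.sub_add_cancel (by omega)]
      omega)
  obtain ⟨w, rfl⟩ := List.length_eq_one_iff.1 hlen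
  refine ⟨G', Classical.decRel _, w, σ, by convert hD, ?_, hG'⟩
  have hS : S = univ.erase w := by
    ext v
    have := hE.mem_iff (v := v)
    simp only [List.mem_singleton] at this
    simp only [mem_erase, mem_univ, and_true]
    tauto
  rw [← hS]; exact hE.cyc

/-- The main result for natural numbers: `m` is the size of the classes, and the degrees are at
least `⌈n/2⌉ + ⌊(n+2)/(2⌊k/2⌋+2)⌋ - m`. -/
theorem hasSpanningCycle_of_le_degree (hk : 2 ≤ k) (h3 : 3 ≤ Fintype.card V)
    (hcol : ∀ u v, G.Adj u v → c u ≠ c v) (hm : ∀ i, #{v | c v = i} = m)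
    (hdeg : ∀ v, (Fintype.card V + 1) / 2 + (Fintype.card V + 2) / (2 * (k / 2 + 1)) ≤
      G.degree v + m)
    (hex : ¬ (4 ∣ Fintype.card V ∧ (k = 2 ∨ m = 2))) : HasSpanningCycle G := by
  have hn := card_eq_mul_of_classes hm
  set n := Fintype.card V with hnV
  obtain ⟨f, hf⟩ : ∃ f, f = (n + 2) / (2 * (k / 2 + 1)) := ⟨_, rfl⟩
  rw [← hf] at hdeg
  have hm1 : 1 ≤ m := by
    rcases Nat.eq_zero_or_pos m with rfl | h
    · omega
    · exact h
  have hf2 : n + 3 ≤ 2 * (k / 2 + 1) * (f + 1) :=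
    hf ▸ Nat.lt_mul_div_succ (n + 2) (by omega)
  rcases eq_or_lt_of_le hk with rfl | hk3
  · -- two classes of odd size
    refine hasSpanningCycle_of_bipartite hm hcol h3 fun v => ?_
    have := hdeg v
    have h4 : ¬ 4 ∣ n := fun h => hex ⟨h, .inl rfl⟩
    norm_num at hf2
    omega
  rcases Nat.lt_or_ge f m with hfm | hfm
  swap
  · refine hasSpanningCycle_of_card_le h3 fun v => ?_
    have := hdeg v
    omega
  obtain ⟨e, he⟩ := Nat.exists_eq_add_of_lt hfm
  have hG : IsBalancedDense G c m ((n + 1) / 2) (n / 2) (e + 1) :=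
    ⟨hcol, hm, by omega, fun v => by have := hdeg v; omega⟩
  have hfe : m - (e + 1) + 1 = f + 1 := by omega
  have hr : n / 2 + 2 ≤ (k / 2 + 1) * (m - (e + 1) + 1) := by
    rw [hfe]; rw [Nat.mul_assoc] at hf2; omega
  by_contra hns
  rcases Nat.even_or_odd k with hke | hko
  · obtain ⟨p, hp⟩ := hke.two_dvd
    have hp' : k / 2 = p := by omega
    have hm2 : m ≠ 2 := by
      rintro rfl
      exact hex ⟨⟨p, by rw [hn, hp]; ring⟩, .inr rfl⟩
    have hH : n = 2 * (p * m) := by rw [hn, hp]; ring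
    -- with `m = 1` the condition would be that of Dirac's theorem
    have hm3 : 3 ≤ m := by
      rcases Nat.lt_or_ge m 2 with h1 | h1
      · have hm1' : m = 1 := by omega
        have : 1 ≤ f := by
          rw [hf, Nat.one_le_div_iff (by omega), hn, hm1']; omega
        omega
      · omega
    rw [hp', Nat.mul_assoc] at hf2
    obtain ⟨b1, b2, b3⟩ := bounds_of_even (p := p) (m := m) (H := (n + 1) / 2) (e := e + 1)
      (by omega) (by omega) hm3 (by omega) (by omega) (by rw [hfe]; omega)
    have h4 : 2 * m ≤ p * m := Nat.mul_le_mul_right _ (by omega)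
    obtain ⟨G', _, w, σ, hD, hM⟩ := hG.exists_missesOne (by omega) (by omega) (by omega)
      (by rw [hp]; exact b3) (by omega) (by omega) hns
    have e1 : n / 2 = (n + 1) / 2 := by omega
    rw [e1] at hD hr
    exact hM.false_of_even hD (p := p) (by omega) hp b1 b2 hm3 (by omega) hr
  · obtain ⟨b1, b2, b3⟩ := bounds_of_odd (k := k) (m := m) (H := (n + 1) / 2) (h := n / 2)
      (e := e + 1) hko (by omega) (by omega) (by omega) (by omega) (by omega)
      (by rw [hfe, ← hn]; exact hf2)
    have h4 : 3 * m ≤ k * m := Nat.mul_le_mul_right _ (by omega)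
    obtain ⟨G', _, w, σ, hD, hM⟩ := hG.exists_missesOne (by omega) (by omega) (by omega)
      b3 (by omega) (by omega) hns
    exact hM.false_of_odd hD hko (by omega) b2 (by omega) hr

end Main

end BalancedPartite

open BalancedPartite in
theorem theorem1 (k : ℕ) (hk : 2 ≤ k) (n : ℕ) (hn : 3 ≤ n)
    {V : Type*} [Fintype V] [DecidableEq V] (hV : Fintype.card V = n)
    (G : SimpleGraph V) [DecidableRel G.Adj] (hG : IsBalancedKPartite G k) :
    -- the Hamiltonicity statement
    (degreeThreshold n k ≤ (G.minDegree : ℚ) →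
      ¬ (4 ∣ n ∧ (k = 2 ∨ (k : ℚ) = (n : ℚ) / 2)) →
      ∃ (a : V) (p : G.Walk a a), p.IsHamiltonianCycle) ∧
    -- the threshold according to the parity of `k`
    (Odd k → degreeThreshold n k
      = (⌈(n : ℚ) / 2⌉ : ℚ) + (⌊((n : ℚ) + 2) / ((k : ℚ) + 1)⌋ : ℚ) - (n : ℚ) / (k : ℚ)) ∧
    (Even k → degreeThreshold n k
      = (n : ℚ) / 2 + (⌊((n : ℚ) + 2) / ((k : ℚ) + 2)⌋ : ℚ) - (n : ℚ) / (k : ℚ)) ∧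
    -- the degree condition of Chen, Faudree, Gould, Jacobson and Lesniak is at least as strong
    ((n : ℚ) / 2 + (n : ℚ) / (2 * (⌈((k : ℚ) + 1) / 2⌉ : ℚ)) - (n : ℚ) / (k : ℚ)
        < (G.minDegree : ℚ) →
      degreeThreshold n k ≤ (G.minDegree : ℚ)) ∧
    -- Dirac's condition for `k = n`, and the condition of Moon and Moser for `k = 2`
    (k = n → degreeThreshold n k = (⌈(n : ℚ) / 2⌉ : ℚ)) ∧
    (k = 2 → degreeThreshold n k = (⌊((n : ℚ) + 2) / 4⌋ : ℚ)) := by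
  obtain ⟨c, m, hm⟩ := hG
  have hkm : n = k * m := by rw [← hV]; exact card_eq_mul_of_classes hm
  have hk0 : (k : ℚ) ≠ 0 := by positivity
  have hmk : (n : ℚ) / k = m := by rw [hkm]; push_cast; field_simp
  have hD := degreeThreshold_eq (n := n) (by omega) hkm
  refine ⟨fun hdeg hex => ?_, fun hko => ?_, fun hke => ?_, fun hlt => ?_, fun hkn => ?_,
    fun hk2 => ?_⟩
  · refine HasSpanningCycle.exists_isHamiltonianCycle ?_ (by omega)
    rw [hD, sub_le_iff_le_add] at hdeg
    refine hasSpanningCycle_of_le_degree (c := c) hk (by omega) (fun u v huv => c.valid huv) hm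
      (fun v => ?_) ?_
    · rw [hV]
      have h1 := G.minDegree_le_degree v
      have h2 : (n + 1) / 2 + (n + 2) / (2 * (k / 2 + 1)) ≤ G.minDegree + m := by
        exact_mod_cast hdeg
      omega
    · rw [hV]
      rintro ⟨h4, h2 | h2⟩
      · exact hex ⟨h4, .inl h2⟩
      · refine hex ⟨h4, .inr ?_⟩
        rw [hkm, h2]; push_cast; ring
  · rw [degreeThreshold, two_mul_ceil,
      show 2 * (k / 2 + 1) = k + 1 by have := Nat.two_mul_div_two_add_one_of_odd hko; omega]
    push_cast; rfl
  · have hne : Even n := by rw [hkm]; exact hke.mul_right m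
    rw [degreeThreshold, two_mul_ceil, ceil_natCast_div_two,
      show 2 * (k / 2 + 1) = k + 2 by have := Nat.two_mul_div_two_of_even hke; omega]
    obtain ⟨b, hb⟩ := hne.two_dvd
    rw [show (n + 1) / 2 = b by omega, hb]
    push_cast
    rw [mul_div_cancel_left₀ _ (two_ne_zero : (2 : ℚ) ≠ 0)]
  · rw [hD, sub_le_iff_le_add]
    rw [two_mul_ceil, hmk, sub_lt_iff_lt_add] at hlt
    have h1 : (k / 2 + 1) * n + n < 2 * (k / 2 + 1) * (G.minDegree + m) := by
      have hr : (0 : ℚ) < ((k / 2 + 1 : ℕ) : ℚ) := by positivity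
      have h2 : ((k / 2 + 1 : ℕ) : ℚ) * n + n <
          2 * ((k / 2 + 1 : ℕ) : ℚ) * (G.minDegree + m) := by
        rw [Nat.cast_mul] at hlt
        generalize ((k / 2 + 1 : ℕ) : ℚ) = r at hlt hr ⊢
        have h3 := mul_lt_mul_of_pos_left hlt (show 0 < 2 * r by positivity)
        have h4 : 2 * r * ((n : ℚ) / 2 + n / ((2 : ℕ) * r)) = r * n + n := by
          push_cast; field_simp
        rwa [h4] at h3
      exact_mod_cast h2
    exact_mod_cast add_div_le_of_lt hk h1
  · have hm1 : m = 1 := by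
      have : k * m = k * 1 := by omega
      exact Nat.eq_of_mul_eq_mul_left (by omega) this
    have h1 : (n + 2) / (2 * (k / 2 + 1)) = 1 := by
      rw [Nat.div_eq_iff (by omega)]; omega
    rw [hD, h1, hm1, ceil_natCast_div_two, Int.cast_natCast, Nat.cast_add, add_sub_cancel_right]
  · have h1 := floor_natCast_div (n + 2) 4
    rw [Nat.cast_add n 2, Nat.cast_ofNat, Nat.cast_ofNat] at h1
    rw [hD, h1, hk2, show (n + 1) / 2 = m by rw [hkm, hk2]; omega, Nat.cast_add,
      add_sub_cancel_left, Int.cast_natCast]
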